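/- **Setting.** A timed automaton $\mathcal A=(L,X,E,\mathcal I)$ has a finite set $L$ of locations, a finite set $X$ of clocks, a finite set $E$ of edges $e=(\ell,g,Y,\ell')$ with $\ell,\ell'\in L$, a guard $g$ and a set $Y\subseteq X$ of clocks to be reset, and an invariant $\mathcal I(\ell)$, which is a guard, for each location $\ell$; a guard is a finite conjunction of constraints $x\sim c$ with $x\in X$, $c\in\mathbb N$, $\sim\,\in\{<,\le,=,\ge,>\}$. A state is a pair $s=(\ell,v)$ with $v\in\mathbb R_+^X$ and $v\models\mathcal I(\ell)$, and $s+\tau=(\ell,v+\tau)$. For an edge $e=(\ell,g,Y,\ell')$ there is a transition $(\ell,v)\xrightarrow{\tau,e}(\ell',v')$ if $v+\tau'\models\mathcal I(\ell)$ for all $0\le\tau'\le\tau$, $v+\tau\models g$, $v'=[Y\leftarrow0](v+\tau)$ and $v'\models\mathcal I(\ell')$. Let $I(s,e)=\{\tau\ge 0\mid \exists s'\ s\xrightarrow{\tau,e}s'\}$ and $I(s)=\bigcup_e I(s,e)$; assume $I(s)\ne\emptyset$ for every state $s$. The edge $e$ is enabled in $s$ if $0\in I(s,e)$. A stochastic timed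 automaton is such an automaton with weights $w_e>0$ $(e\in E)$ and, for each state $s$, a probability measure $\mu_s$ on $\mathbb R_+$ (depending measurably on $s$) such that $\mu_s(I(s))=1$ and $\mu_s$ is equivalent to Lebesgue measure on $I(s)$ if $I(s)$ has positive Lebesgue measure, and to the uniform distribution on the points of $I(s)$ otherwise. In a state $s$, a delay $\tau$ is drawn from $\mu_s$ and then an edge $e$ enabled in $s+\tau$ is drawn with probability $p_{s+\tau}(e)=w_e/\sum_{e'\text{ enabled in }s+\tau}w_{e'}$. Repeating this from a state $s$ gives the probability measure $\mathbb P_{\mathcal A}$ on the infinite runs $s=s_0\xrightarrow{\tau_1,e_1}s_1\xrightarrow{\tau_2,e_2}\cdots$. **Region automaton and fairness.** Fix a region equivalence on $\mathbb R_+^X$ and write $[v]$ for the class (region) of $v$. The edges of the region automaton are $f=\big((\ell,r),r'',e,(\ell',r')\big)$ such that there is a transition $(\ell,v)\xrightarrow{\tau,e}(\ell',v')$ with $v\in r$, $v+\tau\in r''$, $v'\in r'$; the source of $f$ is $(\ell,r)$, and $f$ is enabled in $(\ell,r)$ only. For a state $s=(\ell,v)$ with $v\in r$, $I(s,f)$ is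 the set of the $\tau\in I(s,e)$ such that $v+\tau\in r''$ and the transition $s\xrightarrow{\tau,e}(\ell',v')$ has $v'\in r'$. The edge $f$ is *thin* if $\dim I(s,f)<\dim I(s)$ for some (equivalently, every) state $s=(\ell,v)$ with $v\in r$, and *thick* otherwise. A run $(\ell_0,v_0)\xrightarrow{\tau_1,e_1}(\ell_1,v_1)\xrightarrow{\tau_2,e_2}\cdots$ passes through the locations $q_i=(\ell_i,[v_i])$ of the region automaton and takes its edges $f_i=(q_{i-1},[v_{i-1}+\tau_i],e_i,q_i)$. The run is *fair* if every thick edge $f$ that is enabled in infinitely many $q_i$ satisfies $f_i=f$ for infinitely many $i$. **Theorem.** Let $\mathcal A$ be a stochastic timed automaton with exactly one clock such that * (H3) for every $\ell\in L$ and all $0\le a<b$, the function $v\mapsto\mu_{(\ell,v)}([a,b])$ is continuous on $\{v\in\mathbb R_+^X\mid v\models\mathcal I(\ell)\}$; * (H4) if $s$ and $s'=s+t$ are states, $t\ge0$, $e\in E$, and $0\notin I(s+t',e)$ for all $0\le t'\le t$, then $\mu_s(I(s,e))\le\mu_{s'}(I(s',e))$; * (H5) there is $0<\lambda_0<1$ such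 that $\mu_s([0,1/2])\le\lambda_0$ for every state $s$ with $I(s)$ unbounded. Then, for every state $s$ of $\mathcal A$, the set of fair infinite runs from $s$ is measurable and has probability $1$: $$\mathbb P_{\mathcal A}(s\models\mathsf{fair})=1 .$$ This holds both for the standard regions (with $M$ the maximal constant in guards and invariants, $v\equiv v'$ iff for every clock $x$ either $v(x),v'(x)>M$, or $v(x),v'(x)$ have the same integer part and are both or neither integers, and moreover, for all clocks $x,y$ with $v(x),v(y)\le M$, the fractional parts satisfy $\{v(x)\}\le\{v(y)\}$ iff $\{v'(x)\}\le\{v'(y)\}$) and for the coarser single-clock regions $\{c_i\}$ $(0\le i\le k)$, $(c_i,c_{i+1})$ $(0\le i<k)$, $(c_k,\infty)$, where $0=c_0<\dots<c_k$ are $0$ and the constants in guards and invariants. -/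

import Mathlib

open MeasureTheory ProbabilityTheory
open scoped NNReal ENNReal

namespace TimedAut

noncomputable section

/-! ### Clocks, guards, timed automata -/

/-- Clock valuations over the set `X` of clocks. -/
abbrev Valuation (X : Type*) := X → ℝ≥0

/-- The valuation `v + τ`. -/
def Valuation.shift {X : Type*} (v : Valuation X) (τ : ℝ≥0) : Valuation X := fun x => v x + τ

open Classical in
/-- The valuation `[Y ← 0] v`. -/
def Valuation.reset {X : Type*} (v : Valuation X) (Y : Set X) : Valuation X :=
  fun x => if x ∈ Y then 0 else v x

/-- The comparison symbols `<`, `≤`, `=`, `≥`, `>`. -/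
inductive Comparison
  | lt | le | eq | ge | gt

/-- `a ∼ b` for a comparison symbol `∼`. -/
def Comparison.Holds : Comparison → ℝ≥0 → ℝ≥0 → Prop
  | .lt, a, b => a < b
  | .le, a, b => a ≤ b
  | .eq, a, b => a = b
  | .ge, a, b => a ≥ b
  | .gt, a, b => a > b

/-- An atomic clock constraint `x ∼ c` with `c` a natural number. -/
structure ClockConstraint (X : Type*) where
  clock : X
  cmp : Comparison
  bound : ℕ

/-- A guard: a finite conjunction of atomic clock constraints. -/
abbrev Guard (X : Type*) := List (ClockConstraint X)

/-- `v ⊨ g`. -/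
def Guard.Sat {X : Type*} (g : Guard X) (v : Valuation X) : Prop :=
  ∀ a ∈ g, a.cmp.Holds (v a.clock) a.bound

/-- Edges `(ℓ, g, Y, ℓ')`. -/
structure Edge (L X : Type*) where
  source : L
  guard : Guard X
  resets : Set X
  target : L

/-- Timed automata with locations in `L` and clocks in `X` (finiteness of `L` and `X` is assumed
where it is used). There is no labelling by atomic propositions: it plays no role for fairness. -/
structure TimedAutomaton (L X : Type*) where
  edges : Finset (Edge L X)
  inv : L → Guard X

/-- A location together with a clock valuation. -/
@[ext]
structure Config (L X : Type*) where
  loc : L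
  val : Valuation X

/-- Time elapse `s + τ`. -/
def Config.shift {L X : Type*} (s : Config L X) (τ : ℝ≥0) : Config L X := ⟨s.loc, s.val.shift τ⟩

/-- Discrete σ-algebra on locations, Borel σ-algebra on valuations. -/
instance {L X : Type*} : MeasurableSpace (Config L X) :=
  MeasurableSpace.comap Config.loc ⊤ ⊔ MeasurableSpace.comap Config.val inferInstance

instance {L X : Type*} : MeasurableSpace (Edge L X) := ⊤

namespace TimedAutomaton

variable {L X : Type*} (A : TimedAutomaton L X)

/-- The edges of `A`, as a type. -/
abbrev E := {e : Edge L X // e ∈ A.edges}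

/-- The states of `A`: configurations that satisfy the invariant of their location. -/
abbrev State := {s : Config L X // (A.inv s.loc).Sat s.val}

/-- The transition relation `s --τ,e--> s'`. -/
def Step (s : Config L X) (τ : ℝ≥0) (e : A.E) (s' : Config L X) : Prop :=
  s.loc = e.1.source ∧
  (∀ τ' ≤ τ, (A.inv s.loc).Sat (s.val.shift τ')) ∧
  e.1.guard.Sat (s.val.shift τ) ∧
  s'.loc = e.1.target ∧
  s'.val = (s.val.shift τ).reset e.1.resets ∧
  (A.inv s'.loc).Sat s'.val

/-- `I(s, e)`. -/
def delaysOf (s : Config L X) (e : A.E) : Set ℝ≥0 := {τ | ∃ s', A.Step s τ e s'}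

/-- `I(s)`, the union of the sets `I(s, e)`. -/
def delays (s : Config L X) : Set ℝ≥0 := ⋃ e, A.delaysOf s e

/-- `e` is enabled in `s` (without delay). -/
def Enabled (s : Config L X) (e : A.E) : Prop := (0 : ℝ≥0) ∈ A.delaysOf s e

/-- A move from a state: the state, the delay and the edge that is then taken. -/
abbrev Move := A.State × ℝ≥0 × A.E

/-- The infinite runs from `s`: the `n`-th entry consists of the state `s_n`, the delay `τ_{n+1}`
and the edge `e_{n+1}` of `s = s_0 --τ_1,e_1--> s_1 --τ_2,e_2--> ⋯`. It carries the σ-algebra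
that is generated by the states, delays and edges of a run. -/
abbrev Runs (s : A.State) :=
  {ρ : ℕ → A.Move //
    (ρ 0).1 = s ∧ ∀ n, A.Step (ρ n).1.1 (ρ n).2.1 (ρ n).2.2 (ρ (n + 1)).1.1}

/-! ### Region automata, thickness, fairness -/

/-- `c` is a constant of some guard or invariant of `A`. -/
def IsConstant (c : ℕ) : Prop :=
  (∃ e ∈ A.edges, ∃ a ∈ e.guard, a.bound = c) ∨ ∃ ℓ, ∃ a ∈ A.inv ℓ, a.bound = c

/-- The maximal constant of `A` (`0` if there is none). -/
def maxConstant : ℕ := sSup {c | A.IsConstant c}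

/-- The standard region equivalence. -/
def StandardEquiv (v v' : Valuation X) : Prop :=
  (∀ x, ((A.maxConstant : ℝ≥0) < v x ∧ (A.maxConstant : ℝ≥0) < v' x) ∨
    (⌊(v x : ℝ)⌋ = ⌊(v' x : ℝ)⌋ ∧ (Int.fract (v x : ℝ) = 0 ↔ Int.fract (v' x : ℝ) = 0))) ∧
  ∀ x y, v x ≤ A.maxConstant → v y ≤ A.maxConstant →
    (Int.fract (v x : ℝ) ≤ Int.fract (v y : ℝ) ↔ Int.fract (v' x : ℝ) ≤ Int.fract (v' y : ℝ))

/-- The coarser equivalence that is used for a single clock: if `0 = c_0 < ⋯ < c_k` are `0` and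
the constants of `A`, its classes are `{c_i}`, `(c_i, c_{i+1})` and `(c_k, ∞)`. -/
def CoarseEquiv (v v' : Valuation X) : Prop :=
  ∀ c : ℕ, c = 0 ∨ A.IsConstant c → ∀ x, (v x < c ↔ v' x < c) ∧ (v x = c ↔ v' x = c)

/-- The class of `v` for the equivalence `R`. -/
def region {X : Type*} (R : Valuation X → Valuation X → Prop) (v : Valuation X) :
    Set (Valuation X) := {v' | R v v'}

/-- The location `(ℓ, [v])` of the region automaton to which a configuration `(ℓ, v)` belongs. -/
def regionOf {L X : Type*} (R : Valuation X → Valuation X → Prop) (s : Config L X) :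
    L × Set (Valuation X) := (s.loc, region R s.val)

/-- Candidate edges `(ℓ, r) --guard(r''),e,Y--> (ℓ', r')` of the region automaton; the set `Y` is
that of `e`, and `guard(r'')` is represented by the region `r''`. -/
structure RegionEdge where
  source : L × Set (Valuation X)
  through : Set (Valuation X)
  edge : A.E
  target : L × Set (Valuation X)

/-- The edge of the region automaton that corresponds to `s --τ,e--> s'`. -/
def regionEdgeOf (R : Valuation X → Valuation X → Prop) (s : Config L X) (τ : ℝ≥0) (e : A.E)
    (s' : Config L X) : A.RegionEdge :=
  ⟨regionOf R s, region R (s.val.shift τ), e, regionOf R s'⟩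

/-- The edges of the region automaton. -/
def regionEdges (R : Valuation X → Valuation X → Prop) : Set A.RegionEdge :=
  {f | ∃ s τ e s', A.Step s τ e s' ∧ A.regionEdgeOf R s τ e s' = f}

/-- `I(s, f)` for an edge `f` of the region automaton. -/
def regionDelaysOf (R : Valuation X → Valuation X → Prop) (s : Config L X) (f : A.RegionEdge) :
    Set ℝ≥0 := {τ | ∃ s', A.Step s τ f.edge s' ∧ A.regionEdgeOf R s τ f.edge s' = f}

/-- `I(s)` in the region automaton. -/
def regionDelays (R : Valuation X → Valuation X → Prop) (s : Config L X) : Set ℝ≥0 :=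
  ⋃ f ∈ A.regionEdges R, A.regionDelaysOf R s f

/-- An edge `f` of the region automaton with source `q` is thin if `dim I(s, f) < dim I(s)` for
some `s ∈ q`. The sets involved are finite unions of intervals, for which the Hausdorff dimension is
the usual dimension (`0` or `1`). -/
def Thin (R : Valuation X → Valuation X → Prop) (f : A.RegionEdge) : Prop :=
  ∃ s : A.State, regionOf R s.1 = f.source ∧
    dimH (A.regionDelaysOf R s.1 f) < dimH (A.regionDelays R s.1)

/-- A run is fair if every thick edge of the region automaton that is enabled in infinitely many of
the visited locations of the region automaton is taken infinitely often. -/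
def Fair (R : Valuation X → Valuation X → Prop) {s : A.State} (ρ : A.Runs s) : Prop :=
  ∀ f ∈ A.regionEdges R, ¬ A.Thin R f →
    {n | regionOf R (ρ.1 n).1.1 = f.source}.Infinite →
    {n | A.regionEdgeOf R (ρ.1 n).1.1 (ρ.1 n).2.1 (ρ.1 n).2.2 (ρ.1 (n + 1)).1.1 = f}.Infinite

/-! ### The target of a move -/

/-- The configuration that is reached by delaying `τ` and taking `e`. -/
def targetConfig (m : A.Move) : Config L X :=
  ⟨m.2.2.1.target, (m.1.1.val.shift m.2.1).reset m.2.2.1.resets⟩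

open Classical in
/-- The state after a move (the value is irrelevant for moves that are not transitions). -/
def next (m : A.Move) : A.State :=
  if h : (A.inv (A.targetConfig m).loc).Sat (A.targetConfig m).val
  then ⟨A.targetConfig m, h⟩ else m.1

end TimedAutomaton

/-! ### Stochastic timed automata -/

/-- Lebesgue measure on `ℝ₊`. -/
def lebesgue : Measure ℝ≥0 := (volume : Measure ℝ).comap (fun t : ℝ≥0 => (t : ℝ))

/-- Stochastic timed automata. `I(s) ≠ ∅` for every state `s` (non-blocking) is part of
`delay_delays`. The measurable dependence of the delay distribution on the state is what gives a
meaning to the iterated integrals that define the probability of finite symbolic paths. -/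
structure StochasticTimedAutomaton (L X : Type*) extends TimedAutomaton L X where
  /-- the distribution of the delay in a state -/
  delay : toTimedAutomaton.State → Measure ℝ≥0
  measurable_delay : Measurable delay
  delay_univ : ∀ s, delay s Set.univ = 1
  delay_delays : ∀ s, delay s (toTimedAutomaton.delays s.1) = 1
  /-- `μ_s` is equivalent to Lebesgue measure on `I(s)` if `I(s)` is not a Lebesgue null set -/
  delay_equiv_lebesgue : ∀ s, 0 < lebesgue (toTimedAutomaton.delays s.1) →
    delay s ≪ lebesgue.restrict (toTimedAutomaton.delays s.1) ∧
    lebesgue.restrict (toTimedAutomaton.delays s.1) ≪ delay s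
  /-- and to the uniform distribution on the points of `I(s)` otherwise -/
  delay_equiv_uniform : ∀ s, lebesgue (toTimedAutomaton.delays s.1) = 0 →
    delay s ≪ uniformOn (toTimedAutomaton.delays s.1) ∧
    uniformOn (toTimedAutomaton.delays s.1) ≪ delay s
  /-- the weights of the edges -/
  weight : toTimedAutomaton.E → ℝ≥0
  weight_pos : ∀ e, 0 < weight e

namespace StochasticTimedAutomaton

variable {L X : Type*} (𝒜 : StochasticTimedAutomaton L X)

open Classical in
/-- `p_s(e)`: the probability of the edge `e` in `s`, given by the weights of the enabled edges. -/
def edgeProb (s : Config L X) (e : 𝒜.E) : ℝ≥0 :=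
  if 𝒜.Enabled s e then 𝒜.weight e / ∑ e', if 𝒜.Enabled s e' then 𝒜.weight e' else 0 else 0

end StochasticTimedAutomaton

/-! ### Measurability facts -/

theorem measurable_config_iff {α L X : Type*} [MeasurableSpace α] {f : α → Config L X} :
    Measurable f ↔ (∀ S : Set L, MeasurableSet {a | (f a).loc ∈ S}) ∧
      Measurable fun a => (f a).val := by
  have h : Measurable f ↔ @Measurable _ _ _ ⊤ (fun a => (f a).loc) ∧
      Measurable fun a => (f a).val := by
    rw [measurable_iff_comap_le, measurable_iff_comap_le, measurable_iff_comap_le]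
    simp only [instMeasurableSpaceConfig, MeasurableSpace.comap_sup, MeasurableSpace.comap_comp,
      sup_le_iff]
    rfl
  rw [h]
  exact and_congr ⟨fun h S => h (MeasurableSpace.measurableSet_top (s := S)), fun h S _ => h S⟩
    Iff.rfl

theorem measurable_val {L X : Type*} : Measurable (Config.val : Config L X → Valuation X) :=
  (measurable_config_iff.mp measurable_id).2

theorem measurableSet_loc {L X : Type*} (S : Set L) : MeasurableSet {s : Config L X | s.loc ∈ S} :=
  (measurable_config_iff.mp measurable_id).1 S

theorem measurable_reset {X : Type*} (Y : Set X) :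
    Measurable fun v : Valuation X => v.reset Y := by
  classical
  refine measurable_pi_lambda _ fun x => ?_
  by_cases hx : x ∈ Y
  · simp [Valuation.reset, hx]
  · simpa [Valuation.reset, hx] using measurable_pi_apply x

theorem measurable_shift {L X : Type*} :
    Measurable fun p : Config L X × ℝ≥0 => p.1.shift p.2 := by
  refine measurable_config_iff.mpr ⟨fun S => ?_, measurable_pi_lambda _ fun x => ?_⟩
  · exact measurable_fst (measurableSet_loc S)
  · exact ((measurable_pi_apply x).comp (measurable_val.comp measurable_fst)).add measurable_snd

theorem measurableSet_sat {X : Type*} (g : Guard X) : MeasurableSet {v | g.Sat v} := by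
  have : {v | g.Sat v} = ⋂ a ∈ {a | a ∈ g}, {v | a.cmp.Holds (v a.clock) a.bound} := by
    ext v; simp [Guard.Sat]
  rw [this]
  refine MeasurableSet.biInter g.finite_toSet.countable fun a _ => ?_
  have hm : Measurable fun v : Valuation X => v a.clock := measurable_pi_apply _
  cases h : a.cmp
  · exact measurableSet_lt hm measurable_const
  · exact measurableSet_le hm measurable_const
  · exact measurableSet_eq_fun hm measurable_const
  · exact measurableSet_le measurable_const hm
  · exact measurableSet_lt measurable_const hm

theorem TimedAutomaton.enabled_iff {L X : Type*} (A : TimedAutomaton L X) (s : Config L X)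
    (e : A.E) : A.Enabled s e ↔ s.loc ∈ ({e.1.source} : Set L) ∧ (A.inv e.1.source).Sat s.val ∧
      e.1.guard.Sat s.val ∧ (A.inv e.1.target).Sat (s.val.reset e.1.resets) := by
  have h0 : s.val.shift 0 = s.val := by ext x; simp [Valuation.shift]
  constructor
  · rintro ⟨s', h1, h2, h3, h4, h5, h6⟩
    have := h2 0 le_rfl
    rw [h0] at h3 h5 this
    rw [h4, h5] at h6
    rw [h1] at this
    exact ⟨h1, this, h3, h6⟩
  · rintro ⟨h1, h2, h3, h4⟩
    have h1' : s.loc = e.1.source := h1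
    refine ⟨⟨e.1.target, s.val.reset e.1.resets⟩, h1, fun τ' hτ => ?_, ?_, rfl, ?_, h4⟩
    · rw [nonpos_iff_eq_zero.mp hτ, h0, h1']; exact h2
    · rw [h0]; exact h3
    · rw [h0]

theorem TimedAutomaton.measurableSet_enabled {L X : Type*} (A : TimedAutomaton L X) (e : A.E) :
    MeasurableSet {s | A.Enabled s e} := by
  simp only [A.enabled_iff]
  exact (measurableSet_loc _).inter ((measurable_val (measurableSet_sat _)).inter
    ((measurable_val (measurableSet_sat _)).inter
      (((measurable_reset _).comp measurable_val) (measurableSet_sat _))))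

/-- After a delay `τ ∈ I(s)` some edge is enabled. -/
theorem TimedAutomaton.exists_enabled {L X : Type*} (A : TimedAutomaton L X) {s : Config L X}
    {τ : ℝ≥0} (h : τ ∈ A.delays s) : ∃ e, A.Enabled (s.shift τ) e := by
  obtain ⟨e, s', h1, h2, h3, h4, h5, h6⟩ := Set.mem_iUnion.mp h
  rw [h4, h5] at h6
  exact ⟨e, (A.enabled_iff _ _).mpr ⟨h1, by have := h2 τ le_rfl; rwa [h1] at this, h3, h6⟩⟩

instance {L X : Type*} (A : TimedAutomaton L X) : DiscreteMeasurableSpace A.E :=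
  ⟨fun S => ⟨Subtype.val '' S, trivial, Set.preimage_image_eq S Subtype.val_injective⟩⟩

theorem TimedAutomaton.measurable_next {L X : Type*} (A : TimedAutomaton L X) :
    Measurable A.next := by
  classical
  have key : ∀ e : A.E, Measurable fun p : A.State × ℝ≥0 => A.next (p.1, p.2, e) := by
    intro e
    have hv : Measurable fun p : A.State × ℝ≥0 => (p.1.1.val.shift p.2).reset e.1.resets :=
      (measurable_reset _).comp ((measurable_val.comp measurable_shift).comp
        ((measurable_subtype_coe.comp measurable_fst).prodMk measurable_snd))
    have ht : Measurable fun p : A.State × ℝ≥0 => A.targetConfig (p.1, p.2, e) :=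
      measurable_config_iff.mpr ⟨fun S => MeasurableSet.const (e.1.target ∈ S), hv⟩
    have hs : MeasurableSet {p : A.State × ℝ≥0 |
        (A.inv (A.targetConfig (p.1, p.2, e)).loc).Sat (A.targetConfig (p.1, p.2, e)).val} :=
      hv (measurableSet_sat (A.inv e.1.target))
    have hn : (Subtype.val ∘ fun p : A.State × ℝ≥0 => A.next (p.1, p.2, e)) = fun p =>
        if (A.inv (A.targetConfig (p.1, p.2, e)).loc).Sat (A.targetConfig (p.1, p.2, e)).val
        then A.targetConfig (p.1, p.2, e) else p.1.1 := by
      funext p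
      simp only [TimedAutomaton.next, Function.comp_apply]
      split_ifs <;> rfl
    refine measurable_comap_iff.mpr ?_
    rw [hn]
    exact Measurable.ite hs ht (measurable_subtype_coe.comp measurable_fst)
  have h2 : Measurable fun p : (A.State × ℝ≥0) × A.E => A.next (p.1.1, p.1.2, p.2) :=
    measurable_from_prod_countable_left key
  exact h2.comp ((measurable_fst.prodMk measurable_snd.fst).prodMk measurable_snd.snd)

/-! ### The probability measure on runs -/

namespace StochasticTimedAutomaton

variable {L X : Type*} (𝒜 : StochasticTimedAutomaton L X)

theorem measurable_edgeProb (e : 𝒜.E) : Measurable fun s => 𝒜.edgeProb s e := by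
  classical
  unfold edgeProb
  refine Measurable.ite (𝒜.measurableSet_enabled e) (measurable_const.div ?_) measurable_const
  exact Finset.measurable_sum _ fun e' _ =>
    Measurable.ite (𝒜.measurableSet_enabled e') measurable_const measurable_const

theorem sum_edgeProb_le (s : Config L X) : ∑ e, 𝒜.edgeProb s e ≤ 1 := by
  classical
  have : ∑ e, 𝒜.edgeProb s e = (∑ e, if 𝒜.Enabled s e then 𝒜.weight e else 0) /
      ∑ e, if 𝒜.Enabled s e then 𝒜.weight e else 0 := by
    rw [Finset.sum_div]
    refine Finset.sum_congr rfl fun e _ => ?_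
    unfold edgeProb
    split_ifs <;> simp
  rw [this]
  exact div_self_le_one _

theorem sum_edgeProb_eq {s : Config L X} (h : ∃ e, 𝒜.Enabled s e) :
    ∑ e, 𝒜.edgeProb s e = 1 := by
  classical
  have : ∑ e, 𝒜.edgeProb s e = (∑ e, if 𝒜.Enabled s e then 𝒜.weight e else 0) /
      ∑ e, if 𝒜.Enabled s e then 𝒜.weight e else 0 := by
    rw [Finset.sum_div]
    refine Finset.sum_congr rfl fun e _ => ?_
    unfold edgeProb
    split_ifs <;> simp
  rw [this]
  obtain ⟨e, he⟩ := h
  refine div_self (ne_of_gt ?_)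
  refine lt_of_lt_of_le ?_ (Finset.single_le_sum (fun _ _ => zero_le) (Finset.mem_univ e))
  simpa [he] using 𝒜.weight_pos e

/-- The delay drawn in a state. -/
def delayKernel : Kernel 𝒜.State ℝ≥0 := ⟨𝒜.delay, 𝒜.measurable_delay⟩

instance : IsMarkovKernel 𝒜.delayKernel := ⟨fun s => ⟨𝒜.delay_univ s⟩⟩

/-- The edge drawn in a configuration: `e` has probability `p_s(e)`. -/
def edgeKernel : Kernel (Config L X) 𝒜.E where
  toFun s := ∑ e, (𝒜.edgeProb s e : ℝ≥0∞) • Measure.dirac e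
  measurable' := by
    refine Measure.measurable_of_measurable_coe _ fun B _ => ?_
    simp only [Measure.coe_finsetSum, Finset.sum_apply, Measure.smul_apply, smul_eq_mul]
    exact Finset.measurable_sum _ fun e _ =>
      (𝒜.measurable_edgeProb e).coe_nnreal_ennreal.mul_const _

theorem edgeKernel_univ (s : Config L X) :
    𝒜.edgeKernel s Set.univ = ((∑ e, 𝒜.edgeProb s e : ℝ≥0) : ℝ≥0∞) := by
  change (∑ e, (𝒜.edgeProb s e : ℝ≥0∞) • Measure.dirac e : Measure 𝒜.E) Set.univ = _
  simp [Finset.sum_apply]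

instance : IsFiniteKernel 𝒜.edgeKernel :=
  ⟨⟨1, ENNReal.one_lt_top, fun s => by
    rw [edgeKernel_univ]; exact_mod_cast 𝒜.sum_edgeProb_le s⟩⟩

theorem measurable_elapse : Measurable fun p : 𝒜.State × ℝ≥0 => p.1.1.shift p.2 :=
  measurable_shift.comp ((measurable_subtype_coe.comp measurable_fst).prodMk measurable_snd)

/-- One step from `s`: draw a delay `τ` with law `μ_s`, then an edge `e` with probability
`p_{s+τ}(e)`. -/
def stepKernel : Kernel 𝒜.State (ℝ≥0 × 𝒜.E) :=
  𝒜.delayKernel ⊗ₖ 𝒜.edgeKernel.comap (fun p : 𝒜.State × ℝ≥0 => p.1.1.shift p.2)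
    𝒜.measurable_elapse

instance : IsMarkovKernel 𝒜.stepKernel := by
  refine ⟨fun s => ⟨?_⟩⟩
  have hm : MeasurableSet {τ : ℝ≥0 | ∃ e, 𝒜.Enabled (s.1.shift τ) e} := by
    have h : Measurable fun τ : ℝ≥0 => s.1.shift τ :=
      𝒜.measurable_elapse.comp measurable_prodMk_left
    simp only [Set.ofPred_exists]
    exact MeasurableSet.iUnion fun e => h (𝒜.measurableSet_enabled e)
  have h1 : 𝒜.delay s {τ : ℝ≥0 | ∃ e, 𝒜.Enabled (s.1.shift τ) e} = 1 :=
    le_antisymm (𝒜.delay_univ s ▸ measure_mono (Set.subset_univ _))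
      (𝒜.delay_delays s ▸ measure_mono fun τ hτ => 𝒜.exists_enabled hτ)
  have : IsProbabilityMeasure (𝒜.delay s) := ⟨𝒜.delay_univ s⟩
  have hae : ∀ᵐ τ ∂(𝒜.delay s), ∃ e, 𝒜.Enabled (s.1.shift τ) e :=
    (prob_compl_eq_zero_iff hm).mpr h1
  rw [stepKernel, Kernel.compProd_apply MeasurableSet.univ]
  change ∫⁻ τ, 𝒜.edgeKernel (s.1.shift τ) Set.univ ∂(𝒜.delay s) = 1
  rw [lintegral_congr_ae (g := fun _ => 1)]
  · simp
  · filter_upwards [hae] with τ hτ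
    rw [edgeKernel_univ, 𝒜.sum_edgeProb_eq hτ, ENNReal.coe_one]

/-- One step, together with the state from which it is taken. -/
def moveKernel : Kernel 𝒜.State 𝒜.Move := Kernel.id ×ₖ 𝒜.stepKernel

instance : IsMarkovKernel 𝒜.moveKernel := by unfold moveKernel; infer_instance

/-- The next move, given the first `n + 1` moves: a step from the target of the last of them. -/
def historyKernel (n : ℕ) : Kernel (Finset.Iic n → 𝒜.Move) 𝒜.Move :=
  𝒜.moveKernel.comap (fun h => 𝒜.next (h ⟨n, Finset.mem_Iic.mpr le_rfl⟩))
    (𝒜.measurable_next.comp (measurable_pi_apply _))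

instance (n : ℕ) : IsMarkovKernel (𝒜.historyKernel n) := by unfold historyKernel; infer_instance

/-- The law of the sequence of moves from `s` (by the Ionescu-Tulcea theorem). -/
def law (s : 𝒜.State) : Measure (ℕ → 𝒜.Move) :=
  Kernel.traj (X := fun _ => 𝒜.Move) 𝒜.historyKernel 0 ∘ₘ
    (𝒜.moveKernel s).map fun m (_ : Finset.Iic 0) => m

/-- The probability measure on the infinite runs from `s`. -/
def prob (s : 𝒜.State) : Measure (𝒜.Runs s) := (𝒜.law s).comap Subtype.val

/-! ### The conditions on single-clock automata -/

/-- For every location `ℓ` and all `a < b`, the map `v ↦ μ_{(ℓ,v)}([a,b])` is continuous on the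
valuations `v` for which `(ℓ,v)` is a state. -/
def ContinuousDelays : Prop :=
  ∀ (ℓ : L) (a b : ℝ≥0), a < b →
    Continuous fun v : {v : Valuation X // (𝒜.inv ℓ).Sat v} =>
      𝒜.delay ⟨⟨ℓ, v.1⟩, v.2⟩ (Set.Icc a b)

/-- If `s' = s + t` and `0 ∉ I(s + t', e)` for all `0 ≤ t' ≤ t`, then
`μ_s(I(s, e)) ≤ μ_{s'}(I(s', e))`. -/
def MonotoneDelays : Prop :=
  ∀ (s s' : 𝒜.State) (t : ℝ≥0) (e : 𝒜.E), s'.1 = s.1.shift t →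
    (∀ t' ≤ t, (0 : ℝ≥0) ∉ 𝒜.delaysOf (s.1.shift t') e) →
    𝒜.delay s (𝒜.delaysOf s.1 e) ≤ 𝒜.delay s' (𝒜.delaysOf s'.1 e)

/-- There is `0 < λ₀ < 1` with `μ_s([0,1/2]) ≤ λ₀` for all states `s` with `I(s)` unbounded. -/
def BoundedRates : Prop :=
  ∃ lam : ℝ≥0, 0 < lam ∧ lam < 1 ∧
    ∀ s : 𝒜.State, ¬ BddAbove (𝒜.delays s.1) → 𝒜.delay s (Set.Icc 0 (1 / 2)) ≤ lam

end StochasticTimedAutomaton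
end
end TimedAut

namespace TimedAut.StochasticTimedAutomaton

open Filter

variable {L X : Type*} (𝒜 : StochasticTimedAutomaton L X)

/-! ### Almost sure properties of the law of the moves -/

/-! Guards and invariants are convex, so a pair of delay and edge is a transition as soon as the
edge is enabled after the delay, and the moves form a Markov chain driven by `moveKernel`. The
probabilistic tool is conditional Borel–Cantelli (`ae_frequently_of_frequently_le`): if the
conditional probability of a move in `C` exceeds a fixed positive bound infinitely often, then moves
in `C` occur infinitely often. With one clock, both region equivalences compare the clock with a
finite set `K` of thresholds. There are only countably many region edges, so it is enough to treat
one thick edge `f` with source `q`.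

From each state in `q` the edge `f` has positive probability, but this probability may tend to `0`
as the clock approaches the end of the region. Suppose that `q` is visited infinitely often and `f`
is taken only finitely often. Then no single state recurs: by `ae_frequently_or_eventually`, the
probability of `f` would eventually vanish, contrary to the visits to `q`. As there are finitely
many locations, the clock value `0` occurs only finitely often. Hence resets stop, the clock is
nondecreasing, and its region is eventually constant. This region is not a threshold point, since
then one state would recur.

In a region without thresholds `leave_dichotomy` applies. Either delays from `q` almost surely stay
in the region; then `f` passes through that same region and has probability at least `edgeBound`. Or
the probability of leaving the region is bounded below for all clock values from some visited one
on, by continuity of the delay laws and compactness. Borel–Cantelli yields infinitely many moves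
along `f` in the first case and a departure from the region in the second, and both are
contradictions. -/

theorem ae_law {s : 𝒜.State} {P : (ℕ → 𝒜.Move) → Prop} (hP : MeasurableSet {ρ | P ρ})
    (h : ∀ᵐ m ∂𝒜.moveKernel s,
      ∀ᵐ ρ ∂Kernel.traj (X := fun _ => 𝒜.Move) 𝒜.historyKernel 0 (fun _ => m), P ρ) :
    ∀ᵐ ρ ∂𝒜.law s, P ρ := by
  have hm : Measurable fun (m : 𝒜.Move) (_ : Finset.Iic 0) => m := by fun_prop
  unfold law
  refine Measure.ae_comp_of_ae_ae hP ?_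
  refine (ae_map_iff hm.aemeasurable ?_).mpr h
  have := Kernel.measurable_coe
    (Kernel.traj (X := fun _ => 𝒜.Move) 𝒜.historyKernel 0) hP.compl
  exact this (measurableSet_singleton 0)

theorem ae_law_zero {s : 𝒜.State} {Φ : Set 𝒜.Move} (hΦ : MeasurableSet Φ)
    (h : ∀ᵐ m ∂𝒜.moveKernel s, m ∈ Φ) : ∀ᵐ ρ ∂𝒜.law s, ρ 0 ∈ Φ := by
  refine 𝒜.ae_law (hΦ.preimage (measurable_pi_apply 0)) ?_
  filter_upwards [h] with m hm
  have h1 := Kernel.traj_map_frestrictLe_apply (X := fun _ => 𝒜.Move) (κ := 𝒜.historyKernel) 0 0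
    (fun _ => m)
  rw [Kernel.partialTraj_self, Kernel.id_apply] at h1
  have h2 : ∀ᵐ x ∂((Kernel.traj (X := fun _ => 𝒜.Move) 𝒜.historyKernel 0 (fun _ => m)).map
      (Preorder.frestrictLe 0)), x ⟨0, Finset.mem_Iic.mpr le_rfl⟩ ∈ Φ := by
    rw [h1, ae_dirac_iff (hΦ.preimage (measurable_pi_apply (⟨0, Finset.mem_Iic.mpr le_rfl⟩ : Finset.Iic 0)))]
    exact hm
  exact ae_of_ae_map (Preorder.measurable_frestrictLe 0).aemeasurable h2

/-- The law of move `n + 1` given the earlier ones depends on them only through the state `next`, so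
an almost sure property of one step holds at every step after the first. -/
theorem ae_law_succ {Φ : Set (𝒜.State × 𝒜.Move)} (hΦ : MeasurableSet Φ)
    (h : ∀ s, ∀ᵐ m ∂𝒜.moveKernel s, (s, m) ∈ Φ) (s : 𝒜.State) :
    ∀ᵐ ρ ∂𝒜.law s, ∀ n, (𝒜.next (ρ n), ρ (n + 1)) ∈ Φ := by
  rw [ae_all_iff]
  intro n
  have hm : Measurable fun ρ : ℕ → 𝒜.Move => (𝒜.next (ρ n), ρ (n + 1)) :=
    (𝒜.measurable_next.comp (measurable_pi_apply n)).prodMk (measurable_pi_apply (n + 1))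
  refine 𝒜.ae_law (hΦ.preimage hm) (ae_of_all _ fun m => ?_)
  have h1 := Kernel.partialTraj_compProd_eq_map_traj (X := fun _ => 𝒜.Move)
    (κ := 𝒜.historyKernel) (Nat.zero_le n) (x₀ := fun _ => m)
  have hm2 : Measurable fun p : (Finset.Iic n → 𝒜.Move) × 𝒜.Move =>
      (𝒜.next (p.1 ⟨n, Finset.mem_Iic.mpr le_rfl⟩), p.2) :=
    (𝒜.measurable_next.comp ((measurable_pi_apply (⟨n, Finset.mem_Iic.mpr le_rfl⟩ : Finset.Iic n)).comp
      measurable_fst)).prodMk measurable_snd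
  have h2 : ∀ᵐ p ∂((Kernel.partialTraj (X := fun _ => 𝒜.Move) 𝒜.historyKernel 0 n fun _ => m) ⊗ₘ
      𝒜.historyKernel n), (𝒜.next (p.1 ⟨n, Finset.mem_Iic.mpr le_rfl⟩), p.2) ∈ Φ := by
    refine (Measure.ae_compProd_iff (hΦ.preimage hm2)).mpr (ae_of_all _ fun x => ?_)
    exact h _
  rw [h1] at h2
  have hm3 : Measurable fun ρ : ℕ → 𝒜.Move => (Preorder.frestrictLe n ρ, ρ (n + 1)) :=
    (Preorder.measurable_frestrictLe n).prodMk (measurable_pi_apply (n + 1))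
  exact ae_of_ae_map hm3.aemeasurable h2

theorem measurableSet_frequently {α : Type*} [MeasurableSpace α] {P : ℕ → α → Prop}
    (h : ∀ n, MeasurableSet {a | P n a}) : MeasurableSet {a | ∃ᶠ n in atTop, P n a} := by
  simp only [frequently_atTop, Set.ofPred_forall, Set.ofPred_exists, Set.ofPred_and]
  exact MeasurableSet.iInter fun N => MeasurableSet.iUnion fun n =>
    (MeasurableSet.const _).inter (h n)

/-- A form of the conditional Borel–Cantelli lemma. -/
theorem ae_frequently_of_frequently_le {C : Set 𝒜.Move} (hC : MeasurableSet C) (s : 𝒜.State) :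
    ∀ᵐ ρ ∂𝒜.law s, ∀ j : ℕ,
      (∃ᶠ n in atTop, ((j : ℝ≥0∞) + 1)⁻¹ ≤ 𝒜.moveKernel (𝒜.next (ρ n)) C) →
        ∃ᶠ n in atTop, ρ n ∈ C := by
  rw [ae_all_iff]
  intro j
  have hmk : ∀ n, Measurable fun ρ : ℕ → 𝒜.Move => 𝒜.moveKernel (𝒜.next (ρ n)) C := fun n =>
    (Kernel.measurable_coe _ hC).comp (𝒜.measurable_next.comp (measurable_pi_apply n))
  refine 𝒜.ae_law ?_ (ae_of_all _ fun m => ?_)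
  · have h1 := measurableSet_frequently fun n => measurableSet_le
      (measurable_const (a := ((j : ℝ≥0∞) + 1)⁻¹)) (hmk n)
    have h2 := measurableSet_frequently (P := fun n (ρ : ℕ → 𝒜.Move) => ρ n ∈ C)
      fun n => hC.preimage (measurable_pi_apply n)
    have := h1.compl.union h2
    convert! this using 1
    ext ρ
    simp only [Set.mem_union, Set.mem_compl_iff, Set.mem_ofPred_eq]
    exact imp_iff_not_or
  · set μ := Kernel.traj (X := fun _ => 𝒜.Move) 𝒜.historyKernel 0 (fun _ => m) with hμ
    have hA : ∀ n, MeasurableSet {ρ : ℕ → 𝒜.Move | ρ n ∈ C} := fun n =>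
      hC.preimage (measurable_pi_apply n)
    have hA' : ∀ n, MeasurableSet[Filtration.piLE (X := fun _ => 𝒜.Move) n]
        {ρ : ℕ → 𝒜.Move | ρ n ∈ C} := by
      intro n
      rw [Filtration.piLE_eq_comap_frestrictLe]
      exact ⟨{x | x ⟨n, Finset.mem_Iic.mpr le_rfl⟩ ∈ C}, hC.preimage (measurable_pi_apply _), rfl⟩
    have hBC := ae_mem_limsup_atTop_iff (ℱ := Filtration.piLE (X := fun _ => 𝒜.Move)) μ hA'
    -- Given the moves up to `n`, move `n + 1` has law `moveKernel` at the state reached by move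
    -- `n`.
    have hce : ∀ᵐ ρ ∂μ, ∀ n, (μ[({ρ : ℕ → 𝒜.Move | ρ (n + 1) ∈ C}).indicator
        (1 : (ℕ → 𝒜.Move) → ℝ) | Filtration.piLE (X := fun _ => 𝒜.Move) n]) ρ =
          (𝒜.moveKernel (𝒜.next (ρ n)) C).toReal := by
      rw [ae_all_iff]
      intro n
      have hi : Integrable (({ρ : ℕ → 𝒜.Move | ρ (n + 1) ∈ C}).indicator
          (1 : (ℕ → 𝒜.Move) → ℝ)) μ := (integrable_const (1 : ℝ)).indicator (hA (n + 1))
      filter_upwards [Kernel.condExp_traj (X := fun _ => 𝒜.Move) (κ := 𝒜.historyKernel)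
        (Nat.zero_le n) hi] with ρ hρ
      rw [hρ, integral_indicator_one (hA (n + 1)), Measure.real]
      congr 1
      have h1 := DFunLike.congr_fun (Kernel.map_traj_succ_self (X := fun _ => 𝒜.Move)
        (κ := 𝒜.historyKernel) (a := n)) (Preorder.frestrictLe n ρ)
      have h2 := congrArg (fun ν : Measure 𝒜.Move => ν C) h1
      rw [Kernel.map_apply' _ (measurable_pi_apply (n + 1)) _ hC] at h2
      exact h2
    filter_upwards [hBC, hce] with ρ h1 h2 hf
    have h3 : ρ ∈ limsup (fun n => {ρ : ℕ → 𝒜.Move | ρ n ∈ C}) atTop := by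
      rw [h1]
      simp only [h2]
      -- Infinitely many conditional probabilities are at least `1 / (j + 1)`, so they do not tend
      -- to `0` and their sum diverges.
      refine (not_summable_iff_tendsto_nat_atTop_of_nonneg fun _ => ENNReal.toReal_nonneg).mp ?_
      intro hs
      have h0 := hs.tendsto_atTop_zero
      have hpos : (0 : ℝ) < ((j : ℝ) + 1)⁻¹ := by positivity
      refine hf ?_
      filter_upwards [h0.eventually_lt_const hpos] with n hn hle
      have hle' := ENNReal.toReal_mono (measure_ne_top _ _) hle
      rw [ENNReal.toReal_inv, ENNReal.toReal_add (by simp) (by simp)] at hle'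
      simp only [ENNReal.toReal_natCast, ENNReal.toReal_one] at hle'
      linarith
    rw [mem_limsup_iff_frequently_mem] at h3
    exact h3

end TimedAut.StochasticTimedAutomaton

namespace TimedAut

/-! ### Convexity of guards and the transition relation -/

theorem Comparison.Holds.of_le_of_le {c : Comparison} {a₁ a₂ a₃ b : ℝ≥0} (h₁ : c.Holds a₁ b)
    (h₃ : c.Holds a₃ b) (h₁₂ : a₁ ≤ a₂) (h₂₃ : a₂ ≤ a₃) : c.Holds a₂ b := by
  cases c <;> simp only [Comparison.Holds] at * <;> order

theorem Guard.Sat.of_le_of_le {X : Type*} {g : Guard X} {v₁ v₂ v₃ : Valuation X} (h₁ : g.Sat v₁)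
    (h₃ : g.Sat v₃) (h₁₂ : v₁ ≤ v₂) (h₂₃ : v₂ ≤ v₃) : g.Sat v₂ := fun a ha =>
  (h₁ a ha).of_le_of_le (h₃ a ha) (h₁₂ _) (h₂₃ _)

theorem Valuation.shift_mono {X : Type*} (v : Valuation X) {τ τ' : ℝ≥0} (h : τ ≤ τ') :
    v.shift τ ≤ v.shift τ' := fun x => by simp only [Valuation.shift]; gcongr

theorem Valuation.shift_zero {X : Type*} (v : Valuation X) : v.shift 0 = v := by
  ext x; simp [Valuation.shift]

theorem Valuation.le_shift {X : Type*} (v : Valuation X) (τ : ℝ≥0) : v ≤ v.shift τ :=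
  fun _ => le_self_add

namespace TimedAutomaton

variable {L X : Type*} (A : TimedAutomaton L X)

/-- The invariant holds at the start and after the delay, hence by convexity throughout; only
conditions at the end of the delay remain. -/
theorem step_iff (s : A.State) (τ : ℝ≥0) (e : A.E) (s' : Config L X) :
    A.Step s.1 τ e s' ↔ A.Enabled (s.1.shift τ) e ∧ s' = A.targetConfig (s, τ, e) := by
  rw [A.enabled_iff]
  constructor
  · rintro ⟨h1, h2, h3, h4, h5, h6⟩
    rw [h4, h5] at h6
    have := h2 τ le_rfl
    rw [h1] at this
    exact ⟨⟨h1, this, h3, h6⟩, Config.ext h4 h5⟩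
  · rintro ⟨⟨h1, h2, h3, h4⟩, rfl⟩
    have h1' : s.1.loc = e.1.source := h1
    refine ⟨h1, fun τ' hτ => ?_, h3, rfl, rfl, h4⟩
    refine s.2.of_le_of_le ?_ (s.1.val.le_shift τ') (s.1.val.shift_mono hτ)
    rw [h1']; exact h2

theorem mem_delaysOf_iff (s : A.State) (τ : ℝ≥0) (e : A.E) :
    τ ∈ A.delaysOf s.1 e ↔ A.Enabled (s.1.shift τ) e := by
  simp only [delaysOf, Set.mem_ofPred_eq, step_iff]
  exact ⟨fun ⟨_, h⟩ => h.1, fun h => ⟨_, h, rfl⟩⟩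

theorem mem_delays_iff (s : A.State) (τ : ℝ≥0) :
    τ ∈ A.delays s.1 ↔ ∃ e, A.Enabled (s.1.shift τ) e := by
  simp only [delays, Set.mem_iUnion, mem_delaysOf_iff]

theorem measurable_shift_delay (s : A.State) : Measurable fun τ : ℝ≥0 => s.1.shift τ :=
  measurable_shift.comp measurable_prodMk_left

theorem measurableSet_delays (s : A.State) : MeasurableSet (A.delays s.1) := by
  have : A.delays s.1 = ⋃ e, (fun τ => s.1.shift τ) ⁻¹' {c | A.Enabled c e} := by
    ext τ; simp [A.mem_delays_iff]
  rw [this]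
  exact MeasurableSet.iUnion fun e => A.measurable_shift_delay s (A.measurableSet_enabled e)

theorem next_val_of_enabled {m : A.Move} (h : A.Enabled (m.1.1.shift m.2.1) m.2.2) :
    (A.next m).1 = A.targetConfig m := by
  have h4 : (A.inv (A.targetConfig m).loc).Sat (A.targetConfig m).val :=
    ((A.enabled_iff _ _).mp h).2.2.2
  rw [next, dif_pos h4]

/-- The moves that are transitions. -/
def validMoves : Set A.Move := {m | A.Enabled (m.1.1.shift m.2.1) m.2.2}

theorem measurableSet_validMoves : MeasurableSet A.validMoves := by
  have : A.validMoves = ⋃ e : A.E, (fun m : A.Move => m.2.2) ⁻¹' {e} ∩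
      (fun m : A.Move => m.1.1.shift m.2.1) ⁻¹' {c | A.Enabled c e} := by
    ext m; simp [validMoves]
  rw [this]
  have h1 : Measurable fun m : A.Move => m.1.1.shift m.2.1 := measurable_shift.comp
    ((measurable_subtype_coe.comp measurable_fst).prodMk measurable_snd.fst)
  exact MeasurableSet.iUnion fun e =>
    (measurable_snd.snd (MeasurableSet.of_discrete (s := {e}))).inter
      (h1 (A.measurableSet_enabled e))

/-- Describes runs by a measurable set of moves and the measurable map `next`. -/
theorem mem_runs_iff {s : A.State} {ρ : ℕ → A.Move} :
    ((ρ 0).1 = s ∧ ∀ n, A.Step (ρ n).1.1 (ρ n).2.1 (ρ n).2.2 (ρ (n + 1)).1.1) ↔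
      (ρ 0).1 = s ∧ ∀ n, ρ n ∈ A.validMoves ∧ A.next (ρ n) = (ρ (n + 1)).1 := by
  refine and_congr_right fun _ => forall_congr' fun n => ?_
  rw [step_iff]
  refine and_congr_right fun h => ?_
  rw [Subtype.ext_iff, A.next_val_of_enabled h, eq_comm]

/-! ### Measurability of the set of runs -/

variable [Countable L] [Countable X]

instance : MeasurableEq (Config L X) := by
  refine ⟨?_⟩
  have : Set.diagonal (Config L X) = (⋃ ℓ : L, {p | p.1.loc ∈ ({ℓ} : Set L)} ∩
      {p | p.2.loc ∈ ({ℓ} : Set L)}) ∩ {p | p.1.val = p.2.val} := by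
    ext p
    simp [Config.ext_iff, eq_comm]
  rw [this]
  refine (MeasurableSet.iUnion fun ℓ => ?_).inter ?_
  · exact (measurable_fst (measurableSet_loc {ℓ})).inter (measurable_snd (measurableSet_loc {ℓ}))
  · have : {p : Config L X × Config L X | p.1.val = p.2.val} =
        ⋂ x, {p | p.1.val x = p.2.val x} := by
      ext p; simp [funext_iff]
    rw [this]
    refine MeasurableSet.iInter fun x => measurableSet_eq_fun ?_ ?_
    · exact (measurable_pi_apply x).comp (measurable_val.comp measurable_fst)
    · exact (measurable_pi_apply x).comp (measurable_val.comp measurable_snd)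

theorem measurableSet_eq_state {α : Type*} [MeasurableSpace α] {f g : α → A.State}
    (hf : Measurable f) (hg : Measurable g) : MeasurableSet {a | f a = g a} := by
  simp only [Subtype.ext_iff]
  exact measurableSet_eq_fun (measurable_subtype_coe.comp hf) (measurable_subtype_coe.comp hg)

theorem measurableSet_runs (s : A.State) : MeasurableSet {ρ : ℕ → A.Move |
    (ρ 0).1 = s ∧ ∀ n, A.Step (ρ n).1.1 (ρ n).2.1 (ρ n).2.2 (ρ (n + 1)).1.1} := by
  simp only [mem_runs_iff, Set.ofPred_and, Set.ofPred_forall]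
  refine (A.measurableSet_eq_state (measurable_pi_apply 0).fst measurable_const).inter
    (MeasurableSet.iInter fun n => ?_)
  exact (A.measurableSet_validMoves.preimage (measurable_pi_apply n)).inter
    (A.measurableSet_eq_state (A.measurable_next.comp (measurable_pi_apply n))
      (measurable_pi_apply (n + 1)).fst)

end TimedAutomaton

namespace StochasticTimedAutomaton

variable {L X : Type*} (𝒜 : StochasticTimedAutomaton L X)

/-! ### One step of the process -/

instance (s : 𝒜.State) : IsProbabilityMeasure (𝒜.delay s) := ⟨𝒜.delay_univ s⟩

theorem ae_mem_delays (s : 𝒜.State) : ∀ᵐ τ ∂𝒜.delay s, τ ∈ 𝒜.delays s.1 :=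
  (prob_compl_eq_zero_iff (𝒜.measurableSet_delays s)).mpr (𝒜.delay_delays s)

open Classical in
theorem moveKernel_apply (s : 𝒜.State) {C : Set 𝒜.Move} (hC : MeasurableSet C) :
    𝒜.moveKernel s C =
      ∫⁻ τ, ∑ e, if (s, τ, e) ∈ C then (𝒜.edgeProb (s.1.shift τ) e : ℝ≥0∞) else 0 ∂𝒜.delay s := by
  have hp : Measurable fun p : ℝ≥0 × 𝒜.E => ((s, p) : 𝒜.Move) := measurable_prodMk_left
  rw [moveKernel, Kernel.prod_apply, Kernel.id_apply, Measure.dirac_prod,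
    Measure.map_apply hp hC, stepKernel, Kernel.compProd_apply (hC.preimage hp)]
  refine lintegral_congr fun τ => ?_
  change (∑ e, (𝒜.edgeProb (s.1.shift τ) e : ℝ≥0∞) • Measure.dirac e : Measure 𝒜.E) _ = _
  simp only [Measure.coe_finsetSum, Finset.sum_apply, Measure.smul_apply, smul_eq_mul]
  refine Finset.sum_congr rfl fun e _ => ?_
  rw [Measure.dirac_apply' _ (MeasurableSet.of_discrete)]
  by_cases h : (s, τ, e) ∈ C
  · rw [if_pos h, Set.indicator_of_mem (by exact h)]; simp
  · rw [if_neg h, Set.indicator_of_notMem (by exact h)]; simp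

theorem enabled_of_edgeProb_ne_zero {c : Config L X} {e : 𝒜.E} (h : 𝒜.edgeProb c e ≠ 0) :
    𝒜.Enabled c e := by
  by_contra he
  exact h (by simp [edgeProb, he])

theorem ae_moveKernel_valid (s : 𝒜.State) : ∀ᵐ m ∂𝒜.moveKernel s, m ∈ 𝒜.validMoves := by
  classical
  rw [ae_iff]
  change 𝒜.moveKernel s 𝒜.validMovesᶜ = 0
  rw [𝒜.moveKernel_apply s 𝒜.measurableSet_validMoves.compl]
  refine (lintegral_congr fun τ => Finset.sum_eq_zero fun e _ => ?_).trans lintegral_zero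
  split_ifs with h
  · by_contra h0
    exact h (𝒜.enabled_of_edgeProb_ne_zero (by simpa using h0))
  · rfl

theorem ae_moveKernel_fst [Countable L] [Countable X] (s : 𝒜.State) :
    ∀ᵐ m ∂𝒜.moveKernel s, m.1 = s := by
  classical
  have hC := 𝒜.measurableSet_eq_state (measurable_fst : Measurable fun m : 𝒜.Move => m.1)
    (measurable_const (a := s))
  rw [ae_iff]
  refine (𝒜.moveKernel_apply s hC.compl).trans ?_
  simp

/-- A lower bound for the probabilities of the enabled edges. -/
noncomputable def edgeBound : ℝ≥0 := (∏ e, min 1 (𝒜.weight e)) / (∑ e, 𝒜.weight e + 1)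

theorem edgeBound_pos : 0 < 𝒜.edgeBound := by
  unfold edgeBound
  refine div_pos (Finset.prod_pos fun e _ => lt_min one_pos (𝒜.weight_pos e)) ?_
  positivity

theorem edgeBound_le {c : Config L X} {e : 𝒜.E} (h : 𝒜.Enabled c e) :
    𝒜.edgeBound ≤ 𝒜.edgeProb c e := by
  classical
  rw [edgeProb, if_pos h, edgeBound]
  refine div_le_div₀ zero_le ?_ ?_ ?_
  -- The factor of `e` is at most `weight e` and all other factors are at most `1`.
  · rw [← Finset.mul_prod_erase _ _ (Finset.mem_univ e)]
    calc _ ≤ 𝒜.weight e * 1 := mul_le_mul' (min_le_right _ _)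
          (Finset.prod_le_one' fun _ _ => min_le_left _ _)
      _ = _ := mul_one _
  · refine lt_of_lt_of_le (𝒜.weight_pos e) ?_
    refine le_trans ?_ (Finset.single_le_sum (fun _ _ => zero_le) (Finset.mem_univ e))
    simp [h]
  · refine le_trans (Finset.sum_le_sum fun e' _ => ?_) le_self_add
    split_ifs
    · exact le_rfl
    · exact zero_le

theorem le_moveKernel {s : 𝒜.State} {e : 𝒜.E} {T : Set ℝ≥0} (hT : MeasurableSet T)
    {C : Set 𝒜.Move} (hC : MeasurableSet C) (hTe : T ⊆ 𝒜.delaysOf s.1 e)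
    (hTC : ∀ τ ∈ T, (s, τ, e) ∈ C) : 𝒜.edgeBound * 𝒜.delay s T ≤ 𝒜.moveKernel s C := by
  classical
  rw [𝒜.moveKernel_apply s hC, ← setLIntegral_const]
  refine (setLIntegral_mono' hT fun τ hτ => ?_).trans (setLIntegral_le_lintegral _ _)
  refine le_trans ?_ (Finset.single_le_sum (fun _ _ => zero_le) (Finset.mem_univ e))
  rw [if_pos (hTC τ hτ)]
  exact_mod_cast 𝒜.edgeBound_le ((𝒜.mem_delaysOf_iff s τ e).mp (hTe hτ))

theorem moveKernel_delay {s : 𝒜.State} {T : Set ℝ≥0} (hT : MeasurableSet T)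
    {C : Set 𝒜.Move} (hC : MeasurableSet C) (h : ∀ τ ∈ T, ∀ e, (s, τ, e) ∈ C) :
    𝒜.delay s T ≤ 𝒜.moveKernel s C := by
  classical
  rw [𝒜.moveKernel_apply s hC, ← setLIntegral_one]
  refine (setLIntegral_mono_ae' hT ?_).trans (setLIntegral_le_lintegral _ _)
  filter_upwards [𝒜.ae_mem_delays s] with τ h1 hτ
  simp only [h τ hτ, if_true]
  have := 𝒜.sum_edgeProb_eq ((𝒜.mem_delays_iff s τ).mp h1)
  exact (by exact_mod_cast this.ge)

/-- Almost surely, the sequence of moves is a run. -/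
theorem ae_law_runs [Countable L] [Countable X] (s : 𝒜.State) : ∀ᵐ ρ ∂𝒜.law s,
    (ρ 0).1 = s ∧ ∀ n, 𝒜.Step (ρ n).1.1 (ρ n).2.1 (ρ n).2.2 (ρ (n + 1)).1.1 := by
  have hfst : Measurable fun m : 𝒜.Move => m.1 := measurable_fst
  have h0 := 𝒜.ae_law_zero ((𝒜.measurableSet_eq_state hfst
    (measurable_const (a := s))).inter 𝒜.measurableSet_validMoves)
    ((𝒜.ae_moveKernel_fst s).and (𝒜.ae_moveKernel_valid s))
  have h1 := 𝒜.ae_law_succ ((𝒜.measurableSet_eq_state (f := fun p : 𝒜.State × 𝒜.Move => p.2.1)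
    measurable_snd.fst measurable_fst).inter (𝒜.measurableSet_validMoves.preimage measurable_snd))
    (fun s => (𝒜.ae_moveKernel_fst s).and (𝒜.ae_moveKernel_valid s)) s
  filter_upwards [h0, h1] with ρ h0 h1
  refine 𝒜.mem_runs_iff.mpr ⟨h0.1, fun n => ⟨?_, (h1 n).1.symm⟩⟩
  cases n with
  | zero => exact h0.2
  | succ n => exact (h1 n).2

end StochasticTimedAutomaton
end TimedAut

namespace TimedAut.StochasticTimedAutomaton

open Filter

variable {L X : Type*} (𝒜 : StochasticTimedAutomaton L X)

/-! ### Recurrence -/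

theorem frequently_succ_iff {P : ℕ → Prop} :
    (∃ᶠ n in atTop, P (n + 1)) ↔ ∃ᶠ n in atTop, P n := by
  conv_rhs => rw [← map_add_atTop_eq_nat 1, frequently_map]

/-- The states from which, with a rate that is bounded below in terms of `j`, a move in `D` occurs
within `k` steps. -/
def rateSet (D : Set 𝒜.Move) : ℕ → ℕ → Set 𝒜.State
  | 0, _ => ∅
  | k + 1, j => {s | ((j : ℝ≥0∞) + 1)⁻¹ ≤ 𝒜.moveKernel s (D ∪ 𝒜.next ⁻¹' rateSet D k j)}

theorem measurableSet_rateSet {D : Set 𝒜.Move} (hD : MeasurableSet D) (k j : ℕ) :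
    MeasurableSet (𝒜.rateSet D k j) := by
  induction k with
  | zero => exact MeasurableSet.empty
  | succ k ih =>
    exact measurableSet_le measurable_const
      (Kernel.measurable_coe _ (hD.union (𝒜.measurable_next ih)))

theorem rateSet_mono (D : Set 𝒜.Move) (k : ℕ) {j j' : ℕ} (h : j ≤ j') :
    𝒜.rateSet D k j ⊆ 𝒜.rateSet D k j' := by
  induction k with
  | zero => exact subset_rfl
  | succ k ih =>
    intro s hs
    refine le_trans (le_trans ?_ hs) (measure_mono (Set.union_subset_union_right _
      (Set.preimage_mono ih)))
    exact ENNReal.inv_le_inv.mpr (by gcongr)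

/-- The states from which moves in `D` are almost surely avoided. -/
def avoidSet (D : Set 𝒜.Move) : Set 𝒜.State := {s | ∀ k j, s ∉ 𝒜.rateSet D k j}

theorem measurableSet_avoidSet {D : Set 𝒜.Move} (hD : MeasurableSet D) :
    MeasurableSet (𝒜.avoidSet D) := by
  simp only [avoidSet, Set.ofPred_forall]
  exact MeasurableSet.iInter fun k => MeasurableSet.iInter fun j =>
    (𝒜.measurableSet_rateSet hD k j).compl

theorem exists_inv_le {x : ℝ≥0∞} (h : x ≠ 0) : ∃ j : ℕ, ((j : ℝ≥0∞) + 1)⁻¹ ≤ x := by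
  obtain ⟨n, hn⟩ := ENNReal.exists_inv_nat_lt h
  exact ⟨n, le_trans (ENNReal.inv_le_inv.mpr le_self_add) hn.le⟩

theorem moveKernel_eq_zero_of_mem_avoidSet {D : Set 𝒜.Move} {s : 𝒜.State}
    (hs : s ∈ 𝒜.avoidSet D) (k j : ℕ) :
    𝒜.moveKernel s (D ∪ 𝒜.next ⁻¹' 𝒜.rateSet D k j) = 0 := by
  by_contra h
  obtain ⟨i, hi⟩ := exists_inv_le h
  -- The index `max i j` weakens both rates at once: that of the present step and that of the
  -- remaining `k` steps.
  refine hs (k + 1) (max i j) ?_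
  refine le_trans (le_trans ?_ hi) (measure_mono (Set.union_subset_union_right _
    (Set.preimage_mono (𝒜.rateSet_mono D k (le_max_right i j)))))
  exact ENNReal.inv_le_inv.mpr (by gcongr; exact le_max_left _ _)

theorem ae_next_mem_avoidSet {D : Set 𝒜.Move} {s : 𝒜.State} (hs : s ∈ 𝒜.avoidSet D) :
    ∀ᵐ m ∂𝒜.moveKernel s, 𝒜.next m ∈ 𝒜.avoidSet D := by
  simp only [avoidSet, Set.mem_ofPred_eq]
  refine ae_all_iff.mpr fun k => ae_all_iff.mpr fun j => ?_
  rw [ae_iff]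
  refine measure_mono_null (fun m hm => ?_) (𝒜.moveKernel_eq_zero_of_mem_avoidSet hs k j)
  exact Or.inr (by simpa using hm)

variable [Countable L] [Countable X]

theorem ae_frequently_mem {C : Set 𝒜.Move} (hC : MeasurableSet C) (s : 𝒜.State) :
    ∀ᵐ ρ ∂𝒜.law s, ∀ j : ℕ,
      (∃ᶠ n in atTop, ((j : ℝ≥0∞) + 1)⁻¹ ≤ 𝒜.moveKernel (ρ n).1 C) → ∃ᶠ n in atTop, ρ n ∈ C := by
  filter_upwards [𝒜.ae_law_runs s, 𝒜.ae_frequently_of_frequently_le hC s] with ρ h1 h2 j hj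
  refine h2 j ?_
  simp only [fun n => ((𝒜.mem_runs_iff.mp h1).2 n).2]
  exact frequently_succ_iff.mpr hj

/-- Induction on `k`: Borel–Cantelli for one step gives infinitely many moves in `D`, or infinitely
many visits to the rate set of level `k`. -/
theorem ae_frequently_of_frequently_rateSet {D : Set 𝒜.Move} (hD : MeasurableSet D)
    (s : 𝒜.State) : ∀ᵐ ρ ∂𝒜.law s, ∀ k j : ℕ,
      (∃ᶠ n in atTop, (ρ n).1 ∈ 𝒜.rateSet D k j) → ∃ᶠ n in atTop, ρ n ∈ D := by
  have h := ae_all_iff.mpr fun k : ℕ => ae_all_iff.mpr fun j : ℕ =>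
    𝒜.ae_frequently_mem (hD.union (𝒜.measurable_next (𝒜.measurableSet_rateSet hD k j))) s
  filter_upwards [𝒜.ae_law_runs s, h] with ρ h1 h2 k j
  induction k with
  | zero => intro hf; simp [rateSet] at hf
  | succ k ih =>
    intro hf
    have h3 := h2 k j j hf
    simp only [Set.mem_union, Set.mem_preimage, frequently_or_distrib,
      fun n => ((𝒜.mem_runs_iff.mp h1).2 n).2] at h3
    rcases h3 with h3 | h3
    · exact h3
    · exact ih (frequently_succ_iff.mp h3)

/-- If a state `z` is visited infinitely often, then almost surely moves in `D` occur infinitely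
often or states from which such a move has positive probability are eventually not visited. -/
theorem ae_frequently_or_eventually {D : Set 𝒜.Move} (hD : MeasurableSet D) (s : 𝒜.State) :
    ∀ᵐ ρ ∂𝒜.law s, ∀ z, (∃ᶠ n in atTop, (ρ n).1 = z) →
      (∃ᶠ n in atTop, ρ n ∈ D) ∨ ∀ᶠ n in atTop, 𝒜.moveKernel (ρ n).1 D = 0 := by
  have h3 := 𝒜.ae_law_succ (Φ := {p | p.1 ∈ 𝒜.avoidSet D → 𝒜.next p.2 ∈ 𝒜.avoidSet D}) (by
    have h1 := (𝒜.measurableSet_avoidSet hD)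
    have := (measurable_fst h1).compl.union ((𝒜.measurable_next.comp measurable_snd) h1)
    convert! this using 1
    ext p
    exact imp_iff_not_or)
    (fun s => by
      by_cases hs : s ∈ 𝒜.avoidSet D
      · filter_upwards [𝒜.ae_next_mem_avoidSet hs] with m hm _ using hm
      · exact ae_of_all _ fun m h => absurd h hs) s
  filter_upwards [𝒜.ae_law_runs s, 𝒜.ae_frequently_of_frequently_rateSet hD s, h3]
    with ρ h1 h2 h3 z hz
  -- The exceptional null set is fixed by now, so `z` may range over uncountably many states.
  by_cases hzN : z ∈ 𝒜.avoidSet D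
  · right
    -- A time `n₀ ≥ 1` is taken because `h3` concerns only moves that have a predecessor.
    obtain ⟨n₀, hn₀, hz₀⟩ := frequently_atTop.mp hz 1
    have key : ∀ n ≥ n₀, (ρ n).1 ∈ 𝒜.avoidSet D := by
      intro n hn
      induction n, hn using Nat.le_induction with
      | base => rwa [hz₀]
      | succ n hn ih =>
        obtain ⟨m, rfl⟩ : ∃ m, n = m + 1 := ⟨n - 1, by omega⟩
        have h4 := h3 m
        simp only [fun n => ((𝒜.mem_runs_iff.mp h1).2 n).2] at h4
        exact h4 ih
    filter_upwards [eventually_ge_atTop n₀] with n hn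
    have := 𝒜.moveKernel_eq_zero_of_mem_avoidSet (key n hn) 0 0
    exact measure_mono_null Set.subset_union_left this
  · left
    simp only [avoidSet, Set.mem_ofPred_eq, not_forall, not_not] at hzN
    obtain ⟨k, j, hkj⟩ := hzN
    exact h2 k j (hz.mono fun n hn => by rwa [hn])

end TimedAut.StochasticTimedAutomaton

namespace TimedAut

/-! ### Regions given by thresholds -/

/-- Two valuations are equivalent if they compare in the same way to the thresholds in `K`. -/
def thresholdEquiv {X : Type*} (K : Finset ℕ) (v v' : Valuation X) : Prop :=
  ∀ c ∈ K, ∀ x, (v x < c ↔ v' x < c) ∧ (v x = c ↔ v' x = c)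

section thresholdEquiv

open TimedAutomaton

variable {X : Type*} {K : Finset ℕ} {v v' w : Valuation X}

theorem thresholdEquiv.refl (v : Valuation X) : thresholdEquiv K v v :=
  fun _ _ _ => ⟨Iff.rfl, Iff.rfl⟩

theorem thresholdEquiv.symm (h : thresholdEquiv K v v') : thresholdEquiv K v' v :=
  fun c hc x => ⟨(h c hc x).1.symm, (h c hc x).2.symm⟩

theorem thresholdEquiv.trans (h : thresholdEquiv K v v') (h' : thresholdEquiv K v' w) :
    thresholdEquiv K v w :=
  fun c hc x => ⟨(h c hc x).1.trans (h' c hc x).1, (h c hc x).2.trans (h' c hc x).2⟩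

theorem region_eq_iff : region (thresholdEquiv K) v = region (thresholdEquiv K) v' ↔
    thresholdEquiv K v v' := by
  constructor
  · intro h
    have : v' ∈ region (thresholdEquiv K) v := h ▸ thresholdEquiv.refl v'
    exact this
  · intro h
    ext w
    exact ⟨fun hw => h.symm.trans hw, fun hw => h.trans hw⟩

/-- Regions are order convex; hence a nondecreasing clock that returns to a region has not left it
in between. -/
theorem thresholdEquiv.of_le_of_le (h : thresholdEquiv K v w) (h₁ : v ≤ v') (h₂ : v' ≤ w) :
    thresholdEquiv K v v' := by
  intro c hc x
  obtain ⟨h3, h4⟩ := h c hc x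
  have h1 := h₁ x
  have h2 := h₂ x
  refine ⟨⟨fun h => (h2.trans_lt (h3.mp h)), fun h => h1.trans_lt h⟩,
    fun h => le_antisymm (h2.trans (h4.mp h).le) (h ▸ h1), fun h => ?_⟩
  have h5 : ¬ v x < c := fun h' => absurd (h3.mp h') (not_lt.mpr (h ▸ h2))
  exact le_antisymm (h ▸ h1) (not_lt.mp h5)

theorem thresholdEquiv.holds (h : thresholdEquiv K v v') {c : ℕ} (hc : c ∈ K) (x : X)
    {cmp : Comparison} (hv : cmp.Holds (v x) c) : cmp.Holds (v' x) c := by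
  obtain ⟨h1, h2⟩ := h c hc x
  cases cmp <;> simp only [Comparison.Holds, ge_iff_le, gt_iff_lt] at *
  · exact h1.mp hv
  · rcases hv.lt_or_eq with hv | hv
    · exact (h1.mp hv).le
    · exact (h2.mp hv).le
  · exact h2.mp hv
  · exact not_lt.mp fun h' => absurd (h1.mpr h') (not_lt.mpr hv)
  · refine lt_of_le_of_ne (not_lt.mp fun h' => absurd (h1.mpr h') (not_lt.mpr hv.le)) fun h' => ?_
    exact hv.ne' (h2.mpr h'.symm)

theorem thresholdEquiv.sat (h : thresholdEquiv K v v') {g : Guard X} (hg : ∀ a ∈ g, a.bound ∈ K)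
    (hv : g.Sat v) : g.Sat v' := fun a ha => h.holds (hg a ha) _ (hv a ha)

theorem thresholdEquiv.reset (h : thresholdEquiv K v v') (Y : Set X) :
    thresholdEquiv K (v.reset Y) (v'.reset Y) := by
  intro c hc x
  by_cases hx : x ∈ Y
  · simp [Valuation.reset, hx]
  · simpa [Valuation.reset, hx] using h c hc x

theorem measurableSet_thresholdEquiv [Countable X] (K : Finset ℕ) {α : Type*} [MeasurableSpace α]
    {f g : α → Valuation X} (hf : Measurable f) (hg : Measurable g) :
    MeasurableSet {a | thresholdEquiv K (f a) (g a)} := by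
  simp only [thresholdEquiv, Set.ofPred_forall]
  refine MeasurableSet.iInter fun c => MeasurableSet.iInter fun _ => MeasurableSet.iInter fun x => ?_
  have hfx : Measurable fun a => f a x := (measurable_pi_apply x).comp hf
  have hgx : Measurable fun a => g a x := (measurable_pi_apply x).comp hg
  exact ((measurableSet_lt hfx measurable_const).iff (measurableSet_lt hgx measurable_const)).inter
    ((measurableSet_eq_fun hfx measurable_const).iff (measurableSet_eq_fun hgx measurable_const))

/-- A region is determined by the sets of thresholds above and equal to each clock value, and such
signatures form a countable type. -/
theorem countable_range_region [Finite X] (K : Finset ℕ) :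
    (Set.range (region (thresholdEquiv (X := X) K))).Countable := by
  classical
  let φ : Valuation X → X → Finset ℕ × Finset ℕ :=
    fun v x => (K.filter fun c => v x < c, K.filter fun c => v x = c)
  have hφ : ∀ v v', φ v = φ v' → region (thresholdEquiv K) v = region (thresholdEquiv K) v' := by
    intro v v' h
    refine region_eq_iff.mpr fun c hc x => ?_
    have h1 := congrFun h x
    simp only [φ, Prod.mk.injEq, Finset.ext_iff, Finset.mem_filter] at h1
    exact ⟨by simpa [hc] using h1.1 c, by simpa [hc] using h1.2 c⟩
  let ψ : (X → Finset ℕ × Finset ℕ) → Set (Valuation X) :=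
    fun p => {w | φ w = p}.image (region (thresholdEquiv K)) |>.sUnion
  refine (Set.countable_range ψ).mono ?_
  rintro _ ⟨v, rfl⟩
  refine ⟨φ v, ?_⟩
  ext w
  simp only [ψ, Set.mem_sUnion, Set.mem_image]
  constructor
  · rintro ⟨_, ⟨v', hv', rfl⟩, hw⟩
    rwa [← hφ v' v hv']
  · intro hw
    exact ⟨_, ⟨v, rfl, rfl⟩, hw⟩

end thresholdEquiv

/-! ### The region automaton of a threshold equivalence -/

namespace TimedAutomaton

variable {L X : Type*} (A : TimedAutomaton L X) {K : Finset ℕ}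

theorem finite_isConstant [Finite L] : {c | A.IsConstant c}.Finite := by
  have h1 : (⋃ e ∈ A.edges, ⋃ a ∈ {a | a ∈ e.guard}, {a.bound}).Finite :=
    A.edges.finite_toSet.biUnion fun e _ =>
      (List.finite_toSet e.guard).biUnion fun a _ => Set.finite_singleton _
  have h2 : (⋃ ℓ, ⋃ a ∈ {a | a ∈ A.inv ℓ}, {a.bound}).Finite :=
    Set.finite_iUnion fun ℓ =>
      (List.finite_toSet (A.inv ℓ)).biUnion fun a _ => Set.finite_singleton _
  refine (h1.union h2).subset ?_
  rintro c (⟨e, he, a, ha, rfl⟩ | ⟨ℓ, a, ha, rfl⟩)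
  · exact Or.inl (by simpa using ⟨e, he, a, ha, rfl⟩)
  · exact Or.inr (by simpa using ⟨ℓ, a, ha, rfl⟩)

theorem enabled_of_thresholdEquiv (hK : ∀ c, A.IsConstant c → c ∈ K) {s s' : Config L X}
    (hl : s.loc = s'.loc) (h : thresholdEquiv K s.val s'.val) {e : A.E} (he : A.Enabled s e) :
    A.Enabled s' e := by
  have hi : ∀ ℓ, ∀ a ∈ A.inv ℓ, a.bound ∈ K := fun ℓ a ha => hK _ (Or.inr ⟨ℓ, a, ha, rfl⟩)
  rw [A.enabled_iff] at he ⊢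
  obtain ⟨h1, h2, h3, h4⟩ := he
  exact ⟨hl ▸ h1, h.sat (hi _) h2, h.sat (fun a ha => hK _ (Or.inl ⟨_, e.2, a, ha, rfl⟩)) h3,
    (h.reset _).sat (hi _) h4⟩

theorem regionOf_eq_iff {s s' : Config L X} :
    regionOf (thresholdEquiv K) s = regionOf (thresholdEquiv K) s' ↔
      s.loc = s'.loc ∧ thresholdEquiv K s.val s'.val := by
  simp only [regionOf, Prod.mk.injEq, region_eq_iff]

theorem countable_regionEdges [Finite L] [Finite X] (K : Finset ℕ) :
    (A.regionEdges (thresholdEquiv K)).Countable := by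
  let φ : A.RegionEdge → (L × Set (Valuation X)) × Set (Valuation X) × A.E × L ×
    Set (Valuation X) := fun f => (f.source, f.through, f.edge, f.target)
  have hφ : Function.Injective φ := by
    rintro ⟨⟩ ⟨⟩ h
    simpa [φ] using h
  have hc := countable_range_region (X := X) K
  have ht : ((Set.univ ×ˢ Set.range (region (thresholdEquiv K))) ×ˢ
      Set.range (region (thresholdEquiv K)) ×ˢ Set.univ ×ˢ Set.univ ×ˢ
      Set.range (region (thresholdEquiv K)) : Set ((L × Set (Valuation X)) × Set (Valuation X) ×
        A.E × L × Set (Valuation X))).Countable :=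
    (Set.countable_univ.prod hc).prod (hc.prod (Set.countable_univ.prod
      (Set.countable_univ.prod hc)))
  refine (ht.preimage_of_injOn hφ.injOn).mono ?_
  rintro _ ⟨s, τ, e, s', -, rfl⟩
  simp [φ, regionEdgeOf, regionOf]

/-- The moves that correspond to an edge of the region automaton. -/
def regionMoves (K : Finset ℕ) (f : A.RegionEdge) : Set A.Move :=
  {m | regionOf (thresholdEquiv K) m.1.1 = f.source ∧
    region (thresholdEquiv K) (m.1.1.val.shift m.2.1) = f.through ∧ m.2.2 = f.edge}

variable {A}

theorem enabled_of_mem_regionEdges (hK : ∀ c, A.IsConstant c → c ∈ K) {f : A.RegionEdge}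
    (hf : f ∈ A.regionEdges (thresholdEquiv K)) {s : A.State}
    (hs : regionOf (thresholdEquiv K) s.1 = f.source) {τ : ℝ≥0}
    (hτ : region (thresholdEquiv K) (s.1.val.shift τ) = f.through) :
    A.Enabled (s.1.shift τ) f.edge := by
  obtain ⟨s₀, τ₀, e, s', h, rfl⟩ := hf
  have hs₀ : (A.inv s₀.loc).Sat s₀.val := by
    have := h.2.1 0 zero_le
    rwa [Valuation.shift_zero] at this
  have h1 := ((A.step_iff ⟨s₀, hs₀⟩ τ₀ e s').mp h).1
  exact A.enabled_of_thresholdEquiv (s := s₀.shift τ₀) (s' := s.1.shift τ) hK (regionOf_eq_iff.mp hs).1.symm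
    (region_eq_iff.mp hτ).symm h1

/-- Resets respect the equivalence, so the target of a region edge is determined by its other
components and need not be recorded in `regionMoves`. -/
theorem mem_regionMoves_iff {f : A.RegionEdge}
    (hf : f ∈ A.regionEdges (thresholdEquiv K)) (m : A.Move) :
    m ∈ A.regionMoves K f ↔
      A.regionEdgeOf (thresholdEquiv K) m.1.1 m.2.1 m.2.2 (A.targetConfig m) = f := by
  constructor
  · rintro ⟨h1, h2, h3⟩
    obtain ⟨s₀, τ₀, e, s', h, rfl⟩ := hf
    obtain ⟨-, -, -, h4, h5, -⟩ := h
    have h6 := (region_eq_iff.mp h2).reset e.1.resets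
    rw [← h5] at h6
    change m.2.2 = e at h3
    simp only [regionEdgeOf, RegionEdge.mk.injEq, regionOf_eq_iff]
    refine ⟨regionOf_eq_iff.mp h1, h2, h3, ?_, ?_⟩
    · rw [h4, ← h3]; rfl
    · rw [← h3] at h6; exact h6
  · rintro rfl
    exact ⟨rfl, rfl, rfl⟩

theorem regionDelaysOf_eq (hK : ∀ c, A.IsConstant c → c ∈ K) {f : A.RegionEdge}
    (hf : f ∈ A.regionEdges (thresholdEquiv K)) {s : A.State}
    (hs : regionOf (thresholdEquiv K) s.1 = f.source) :
    A.regionDelaysOf (thresholdEquiv K) s.1 f =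
      {τ | region (thresholdEquiv K) (s.1.val.shift τ) = f.through} := by
  ext τ
  constructor
  · rintro ⟨s', -, h⟩
    exact congrArg RegionEdge.through h
  · intro hτ
    have he := enabled_of_mem_regionEdges hK hf hs hτ
    exact ⟨_, (A.step_iff s τ _ _).mpr ⟨he, rfl⟩,
      (mem_regionMoves_iff hf (s, τ, f.edge)).mp ⟨hs, hτ, rfl⟩⟩

theorem measurableSet_regionMoves [Countable X] {f : A.RegionEdge}
    (hf : f ∈ A.regionEdges (thresholdEquiv K)) : MeasurableSet (A.regionMoves K f) := by
  obtain ⟨s₀, τ₀, e, s', h, rfl⟩ := hf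
  have h1 : Measurable fun m : A.Move => m.1.1 := measurable_subtype_coe.comp measurable_fst
  have h2 : Measurable fun m : A.Move => m.1.1.val.shift m.2.1 :=
    measurable_val.comp (measurable_shift.comp (h1.prodMk measurable_snd.fst))
  have : A.regionMoves K (A.regionEdgeOf (thresholdEquiv K) s₀ τ₀ e s') =
      ({m | m.1.1.loc ∈ ({s₀.loc} : Set L)} ∩ {m | thresholdEquiv K s₀.val m.1.1.val}) ∩
        ({m | thresholdEquiv K (s₀.val.shift τ₀) (m.1.1.val.shift m.2.1)} ∩
          {m | m.2.2 ∈ ({e} : Set A.E)}) := by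
    ext m
    simp only [regionMoves, regionEdgeOf, regionOf_eq_iff, region_eq_iff, Set.mem_ofPred_eq,
      Set.mem_inter_iff, Set.mem_singleton_iff]
    exact ⟨fun h => ⟨⟨h.1.1, h.1.2.symm⟩, h.2.1.symm, h.2.2⟩,
      fun h => ⟨⟨h.1.1, h.1.2.symm⟩, h.2.1.symm, h.2.2⟩⟩
  rw [this]
  exact ((h1 (measurableSet_loc _)).inter
    (measurableSet_thresholdEquiv K measurable_const (measurable_val.comp h1))).inter
    ((measurableSet_thresholdEquiv K measurable_const h2).inter
      (measurable_snd.snd (MeasurableSet.of_discrete (s := {e}))))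

theorem measurableSet_regionOf [Countable X] (s₀ : Config L X) :
    MeasurableSet {s : A.State | regionOf (thresholdEquiv K) s.1 =
      regionOf (thresholdEquiv K) s₀} := by
  have : {s : A.State | regionOf (thresholdEquiv K) s.1 = regionOf (thresholdEquiv K) s₀} =
      Subtype.val ⁻¹' ({s | s.loc ∈ ({s₀.loc} : Set L)} ∩ {s | thresholdEquiv K s₀.val s.val}) := by
    ext s
    simp only [regionOf_eq_iff, Set.mem_ofPred_eq, Set.mem_preimage, Set.mem_inter_iff,
      Set.mem_singleton_iff]
    exact ⟨fun h => ⟨h.1, h.2.symm⟩, fun h => ⟨h.1, h.2.symm⟩⟩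
  rw [this]
  exact measurable_subtype_coe ((measurableSet_loc _).inter
    (measurableSet_thresholdEquiv K measurable_const measurable_val))

end TimedAutomaton
end TimedAut

namespace TimedAut

open TimedAutomaton Filter Topology

/-! ### Lebesgue measure on the nonnegative reals -/

theorem lebesgue_apply (S : Set ℝ≥0) : lebesgue S = volume ((fun t : ℝ≥0 => (t : ℝ)) '' S) :=
  (MeasurableEmbedding.subtype_coe measurableSet_Ici).comap_apply _ _

theorem lebesgue_Icc_pos {a b : ℝ≥0} (h : a < b) : 0 < lebesgue (Set.Icc a b) := by
  have : (fun t : ℝ≥0 => (t : ℝ)) '' Set.Icc a b = Set.Icc (a : ℝ) b := by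
    ext x
    constructor
    · rintro ⟨t, ht, rfl⟩
      exact ⟨NNReal.coe_le_coe.mpr ht.1, NNReal.coe_le_coe.mpr ht.2⟩
    · rintro ⟨h1, h2⟩
      have hx : 0 ≤ x := a.2.trans h1
      exact ⟨⟨x, hx⟩, ⟨h1, h2⟩, rfl⟩
  rw [lebesgue_apply, this, Real.volume_Icc, ENNReal.ofReal_pos]
  exact sub_pos.mpr (NNReal.coe_lt_coe.mpr h)

theorem lebesgue_eq_zero_of_finite {S : Set ℝ≥0} (h : S.Finite) : lebesgue S = 0 := by
  rw [lebesgue_apply]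
  exact (h.image _).measure_zero _

theorem one_le_dimH_of_lebesgue_pos {S : Set ℝ≥0} (h : 0 < lebesgue S) : 1 ≤ dimH S := by
  have hi : Isometry fun t : ℝ≥0 => (t : ℝ) := isometry_subtype_coe
  rw [← hi.dimH_image]
  have := le_dimH_of_hausdorffMeasure_ne_zero (d := 1) (s := (fun t : ℝ≥0 => (t : ℝ)) '' S) (by
    rw [NNReal.coe_one, hausdorffMeasure_real, ← lebesgue_apply]
    exact h.ne')
  simpa using this

theorem ordConnected_shift_region {X : Type*} {K : Finset ℕ} (v : Valuation X)
    (r : Set (Valuation X)) :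
    {τ | region (thresholdEquiv K) (v.shift τ) = r}.OrdConnected := by
  refine ⟨fun τ₁ h₁ τ₂ h₂ τ hτ => ?_⟩
  have h12 := region_eq_iff.mp (h₁.trans h₂.symm : region _ _ = region _ _)
  have h1 := h12.of_le_of_le (v.shift_mono hτ.1) (v.shift_mono hτ.2)
  exact (region_eq_iff.mpr h1).symm.trans h₁

namespace StochasticTimedAutomaton

variable {L X : Type*} (𝒜 : StochasticTimedAutomaton L X)

/-! ### Positivity of the probability of a thick edge -/

theorem delay_Icc_pos {s : 𝒜.State} {a b : ℝ≥0} (hab : a < b)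
    (h : Set.Icc a b ⊆ 𝒜.delays s.1) : 0 < 𝒜.delay s (Set.Icc a b) := by
  have h0 := (lebesgue_Icc_pos hab).trans_le (measure_mono h)
  refine pos_iff_ne_zero.mpr fun h1 => ?_
  have h2 := (𝒜.delay_equiv_lebesgue s h0).2 h1
  rw [Measure.restrict_apply measurableSet_Icc, Set.inter_eq_left.mpr h] at h2
  exact (lebesgue_Icc_pos hab).ne' h2

theorem delay_singleton_ne_zero {s : 𝒜.State} (h0 : lebesgue (𝒜.delays s.1) = 0) {τ : ℝ≥0}
    (hτ : τ ∈ 𝒜.delays s.1) : 𝒜.delay s {τ} ≠ 0 := by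
  obtain ⟨h1, h2⟩ := 𝒜.delay_equiv_uniform s h0
  -- On an infinite set `uniformOn` is the zero measure, which cannot dominate a probability
  -- measure.
  have hfin : (𝒜.delays s.1).Finite := by
    refine finite_of_uniformOn_ne_zero (t := Set.univ) fun h => ?_
    have := h1 h
    rw [𝒜.delay_univ] at this
    exact one_ne_zero this
  intro h
  have h3 := (uniformOn_eq_zero_iff hfin).mp (h2 h)
  exact Set.notMem_empty τ (h3 ▸ ⟨hτ, rfl⟩)

variable {𝒜} {K : Finset ℕ}

/-- With a single clock, a target value above the present one is reached by waiting. A target value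
below it lies between two points of the source region, hence in that region, and delay `0` works. -/
theorem exists_shift_mem [Unique X] {f : 𝒜.RegionEdge}
    (hf : f ∈ 𝒜.regionEdges (thresholdEquiv K)) {s : Config L X}
    (hs : regionOf (thresholdEquiv K) s = f.source) :
    ∃ τ, region (thresholdEquiv K) (s.val.shift τ) = f.through := by
  obtain ⟨s₀, τ₀, e, s', h, rfl⟩ := hf
  have h1 := (regionOf_eq_iff.mp hs).2
  rcases le_total (s.val default) (s₀.val.shift τ₀ default) with h2 | h2
  · refine ⟨s₀.val.shift τ₀ default - s.val default, congrArg _ ?_⟩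
    ext x
    rw [Unique.eq_default x, Valuation.shift, add_tsub_cancel_of_le h2]
  · refine ⟨0, region_eq_iff.mpr ?_⟩
    rw [Valuation.shift_zero]
    refine h1.trans (h1.symm.of_le_of_le (s₀.val.le_shift τ₀) fun x => ?_)
    rwa [Unique.eq_default x]

/-- If `I(s)` is a null set, each of its points has positive mass. Otherwise `I(s)` has dimension at
least `1`, so thickness forces `I(s, f)` to have two points, and by convexity it contains an
interval. -/
theorem delay_regionDelaysOf_ne_zero [Unique X] (hK : ∀ c, 𝒜.IsConstant c → c ∈ K)
    {f : 𝒜.RegionEdge} (hf : f ∈ 𝒜.regionEdges (thresholdEquiv K))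
    (ht : ¬ 𝒜.Thin (thresholdEquiv K) f) {s : 𝒜.State}
    (hs : regionOf (thresholdEquiv K) s.1 = f.source) :
    𝒜.delay s {τ | region (thresholdEquiv K) (s.1.val.shift τ) = f.through} ≠ 0 := by
  have hen : {τ | region (thresholdEquiv K) (s.1.val.shift τ) = f.through} ⊆ 𝒜.delays s.1 :=
    fun τ hτ => (𝒜.mem_delays_iff s τ).mpr ⟨_, enabled_of_mem_regionEdges hK hf hs hτ⟩
  obtain ⟨τ, hτ⟩ := exists_shift_mem hf hs
  rcases eq_or_ne (lebesgue (𝒜.delays s.1)) 0 with h0 | h0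
  · exact fun h => 𝒜.delay_singleton_ne_zero h0 (hen hτ)
      (measure_mono_null (Set.singleton_subset_iff.mpr hτ) h)
  · have h1 : 𝒜.delays s.1 ⊆ 𝒜.regionDelays (thresholdEquiv K) s.1 := by
      intro τ hτ
      obtain ⟨e, s', h⟩ := Set.mem_iUnion.mp hτ
      exact Set.mem_biUnion (x := 𝒜.regionEdgeOf (thresholdEquiv K) s.1 τ e s')
        ⟨_, _, _, _, h, rfl⟩ ⟨s', h, rfl⟩
    have h2 : ¬ {τ | region (thresholdEquiv K) (s.1.val.shift τ) = f.through}.Subsingleton := by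
      intro hsub
      refine ht ⟨s, hs, ?_⟩
      rw [regionDelaysOf_eq hK hf hs, dimH_subsingleton hsub]
      exact one_pos.trans_le ((one_le_dimH_of_lebesgue_pos (pos_iff_ne_zero.mpr h0)).trans
        (dimH_mono h1))
    rw [Set.not_subsingleton_iff] at h2
    obtain ⟨a, ha, b, hb, hab⟩ := h2.exists_lt
    have h3 := (ordConnected_shift_region s.1.val f.through).out ha hb
    exact fun h => (𝒜.delay_Icc_pos hab (h3.trans hen)).ne' (measure_mono_null h3 h)

/-! ### Leaving a region -/

theorem exists_Icc_thresholdEquiv [Unique X] {v : Valuation X} (hv : ∀ c ∈ K, v default ≠ c) :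
    ∃ b > v default, ∀ w : Valuation X, v default ≤ w default → w default ≤ b →
      thresholdEquiv K v w := by
  have h : ∀ᶠ u : ℝ≥0 in 𝓝 (v default), ∀ c ∈ K,
      (v default < (c : ℝ≥0) ↔ u < c) ∧ u ≠ c := by
    rw [Filter.eventually_all_finset]
    intro c hc
    rcases (hv c hc).lt_or_gt with h | h
    · filter_upwards [gt_mem_nhds h] with u hu
      exact ⟨iff_of_true h hu, hu.ne⟩
    · filter_upwards [lt_mem_nhds h] with u hu
      exact ⟨iff_of_false h.not_gt hu.not_gt, hu.ne'⟩
  obtain ⟨b, hb, hsub⟩ := exists_Ico_subset_of_mem_nhds h ⟨v default + 1, by simp⟩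
  obtain ⟨b', h1, h2⟩ := exists_between hb
  refine ⟨b', h1, fun w hw1 hw2 c hc x => ?_⟩
  rw [Unique.eq_default x]
  have h3 := hsub ⟨hw1, hw2.trans_lt h2⟩ c hc
  exact ⟨h3.1, iff_of_false (hv c hc) h3.2⟩

/-- On a compact interval of clock values from which an interval beyond it can be reached, the
probability to get there is bounded away from `0`. -/
theorem exists_le_delay_of_Icc [Unique X] (h3 : 𝒜.ContinuousDelays) {ℓ : L} {t₀ c w b : ℝ≥0}
    (hcw : c < w) (hwb : w < b)
    (hen : ∀ t ≤ c, ∀ τ, w ≤ t + τ → t + τ ≤ b → ∃ e, 𝒜.Enabled ⟨ℓ, fun _ => t + τ⟩ e)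
    (hinv : ∀ t, t₀ ≤ t → t ≤ c → (𝒜.inv ℓ).Sat fun _ => t) :
    ∃ ε : ℝ≥0∞, ε ≠ 0 ∧ ∀ t ∈ Set.Icc t₀ c, ∀ h : (𝒜.inv ℓ).Sat fun _ => t,
      ε ≤ 𝒜.delay ⟨⟨ℓ, fun _ => t⟩, h⟩ {τ | w ≤ t + τ} := by
  -- Such bounds pass to subsets and finite unions, so by compactness a bound near each point
  -- suffices.
  refine isCompact_Icc.induction_on (p := fun S => ∃ ε : ℝ≥0∞, ε ≠ 0 ∧ ∀ t ∈ S,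
    ∀ h : (𝒜.inv ℓ).Sat fun _ => t, ε ≤ 𝒜.delay ⟨⟨ℓ, fun _ => t⟩, h⟩ {τ | w ≤ t + τ})
    ⟨1, one_ne_zero, by simp⟩ ?_ ?_ ?_
  · rintro S T hST ⟨ε, h0, h⟩
    exact ⟨ε, h0, fun t ht => h t (hST ht)⟩
  · rintro S T ⟨ε, h0, h⟩ ⟨ε', h0', h'⟩
    refine ⟨min ε ε', by simp [h0, h0', min_eq_iff], ?_⟩
    rintro t (ht | ht) hi
    · exact (min_le_left _ _).trans (h t ht hi)
    · exact (min_le_right _ _).trans (h' t ht hi)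
  · rintro t ⟨ht0, htc⟩
    -- From `t`, the delays in `[a, a + δ]` lead into `[w + δ, w + 2δ]`, inside `[w, b]`. The margin
    -- `δ` above `w` keeps the target at least `w` when `t` is replaced by a nearby `u > t - δ`.
    obtain ⟨δ, hδ, hδb⟩ : ∃ δ > 0, w + δ + δ ≤ b := by
      refine ⟨(b - w) / 2, div_pos (tsub_pos_of_lt hwb) two_pos, ?_⟩
      rw [add_assoc, add_halves, add_tsub_cancel_of_le hwb.le]
    have htw : t ≤ w := htc.trans hcw.le
    set a := w - t + δ with ha
    have hta : t + a = w + δ := by rw [ha, ← add_assoc, add_tsub_cancel_of_le htw]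
    have hpos : 0 < 𝒜.delay ⟨⟨ℓ, fun _ => t⟩, hinv t ht0 htc⟩ (Set.Icc a (a + δ)) := by
      refine 𝒜.delay_Icc_pos (lt_add_of_pos_right a hδ) fun τ hτ => ?_
      refine (𝒜.mem_delays_iff _ τ).mpr (hen t htc τ ?_ ?_)
      · exact le_self_add.trans (hta.symm.le.trans (by gcongr; exact hτ.1))
      · refine le_trans ?_ hδb
        rw [← hta, add_assoc]
        gcongr
        exact hτ.2
    obtain ⟨ε, hε0, hε⟩ := exists_between hpos
    have hc := ((h3 ℓ a (a + δ) (lt_add_of_pos_right a hδ)).tendsto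
      ⟨fun _ => t, hinv t ht0 htc⟩).eventually_const_lt hε
    rw [nhds_subtype_eq_comap, eventually_comap] at hc
    have hcont : Continuous fun (u : ℝ≥0) (_ : X) => u := by fun_prop
    have hc' := hcont.continuousAt.eventually hc
    have hlt : ∀ᶠ u in 𝓝 t, t < u + δ :=
      ((continuous_id.add continuous_const).tendsto t).eventually_const_lt
        (lt_add_of_pos_right t hδ)
    refine ⟨_, mem_nhdsWithin_of_mem_nhds (hc'.and hlt), ε, hε0.ne', ?_⟩
    rintro u ⟨hu, hu'⟩ hi
    refine (hu ⟨_, hi⟩ rfl).le.trans (measure_mono fun τ hτ => ?_)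
    have h1 : w + δ ≤ (u + τ) + δ := by
      rw [← hta, add_right_comm]
      exact add_le_add hu'.le hτ.1
    exact le_of_add_le_add_right h1

/-- In an open region in which some edge is enabled in the location `ℓ`, either the region is
almost surely not left by a delay, or the probability to leave it is bounded away from `0` beyond
each of its points. -/
theorem leave_dichotomy [Unique X] (h3 : 𝒜.ContinuousDelays)
    (hK : ∀ c, 𝒜.IsConstant c → c ∈ K) {s₀ : 𝒜.State} (hgap : ∀ c ∈ K, s₀.1.val default ≠ c)
    (hstay : ∃ τ e, 𝒜.Enabled (s₀.1.shift τ) e ∧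
      thresholdEquiv K s₀.1.val (s₀.1.val.shift τ)) :
    (∀ s : 𝒜.State, regionOf (thresholdEquiv K) s.1 = regionOf (thresholdEquiv K) s₀.1 →
      𝒜.delay s {τ | ¬ thresholdEquiv K s.1.val (s.1.val.shift τ)} = 0) ∨
    ∃ ε : ℝ≥0∞, ε ≠ 0 ∧ ∀ s : 𝒜.State,
      regionOf (thresholdEquiv K) s.1 = regionOf (thresholdEquiv K) s₀.1 →
      s₀.1.val ≤ s.1.val → ε ≤ 𝒜.delay s {τ | ¬ thresholdEquiv K s.1.val (s.1.val.shift τ)} := by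
  refine or_iff_not_imp_left.mpr fun hne => ?_
  push Not at hne
  obtain ⟨s₁, hs₁, hne⟩ := hne
  obtain ⟨hl₁, hr₁⟩ := regionOf_eq_iff.mp hs₁
  have hgap₁ : ∀ c ∈ K, s₁.1.val default ≠ c := fun c hc h =>
    hgap c hc ((hr₁ c hc default).2.mp h)
  -- the set of possible delays is not null
  have hleb : 0 < lebesgue (𝒜.delays s₁.1) := by
    obtain ⟨τ, e, he, hτ⟩ := hstay
    obtain ⟨b, hb, hsub⟩ := exists_Icc_thresholdEquiv hgap₁
    refine (lebesgue_Icc_pos (tsub_pos_of_lt hb)).trans_le (measure_mono fun τ' hτ' => ?_)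
    refine (𝒜.mem_delays_iff s₁ τ').mpr ⟨e, ?_⟩
    refine 𝒜.enabled_of_thresholdEquiv (s := s₀.1.shift τ) (s' := s₁.1.shift τ') hK hl₁.symm
      (hτ.symm.trans (hr₁.symm.trans (hsub (s₁.1.val.shift τ') le_self_add ?_))) he
    calc s₁.1.val default + τ' ≤ s₁.1.val default + (b - s₁.1.val default) := by
          gcongr; exact hτ'.2
      _ = b := add_tsub_cancel_of_le hb.le
  -- a delay that leaves the region and leads to no threshold
  obtain ⟨τ₁, hτd, hτr, hτK⟩ : ∃ τ ∈ 𝒜.delays s₁.1,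
      ¬ thresholdEquiv K s₁.1.val (s₁.1.val.shift τ) ∧
        ∀ c ∈ K, s₁.1.val.shift τ default ≠ c := by
    by_contra hcon
    push Not at hcon
    refine hne ((𝒜.delay_equiv_lebesgue s₁ hleb).1 ?_)
    rw [Measure.restrict_apply' (𝒜.measurableSet_delays s₁)]
    have hfin : (⋃ c ∈ K, {τ : ℝ≥0 | s₁.1.val default + τ = c}).Finite := by
      refine K.finite_toSet.biUnion fun c _ => Set.Subsingleton.finite ?_
      intro τ h τ' h'
      exact add_left_cancel (h.trans h'.symm)
    refine measure_mono_null ?_ (lebesgue_eq_zero_of_finite hfin)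
    rintro τ ⟨h1, h2⟩
    obtain ⟨c, hc, h⟩ := hcon τ h2 h1
    exact Set.mem_biUnion hc h
  set w := s₁.1.val.shift τ₁ with hw
  have hle : s₁.1.val default ≤ w default := le_self_add
  -- Neither value is a threshold, so inequivalence means that a threshold lies strictly between
  -- them; it bounds the whole region from above.
  obtain ⟨c, hc, hvc, hcw⟩ : ∃ c ∈ K, s₁.1.val default < c ∧ (c : ℝ≥0) < w default := by
    by_contra hcon
    push Not at hcon
    refine hτr fun c hc x => ?_
    rw [Unique.eq_default x]
    refine ⟨⟨fun h => (hcon c hc h).lt_of_ne (hτK c hc), fun h => hle.trans_lt h⟩,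
      iff_of_false (hgap₁ c hc) (hτK c hc)⟩
  obtain ⟨b, hb, hsub⟩ := exists_Icc_thresholdEquiv hτK
  obtain ⟨e, he⟩ := (𝒜.mem_delays_iff s₁ τ₁).mp hτd
  have hlt : ∀ s : 𝒜.State, regionOf (thresholdEquiv K) s.1 = regionOf (thresholdEquiv K) s₀.1 →
      s.1.val default < c := fun s hs =>
    ((regionOf_eq_iff.mp (hs.trans hs₁.symm)).2 c hc default).1.mpr hvc
  -- The interval starts at the clock value of `s₀`, since the region need not contain its left end.
  -- The invariant holds up to `c` because it holds at `s₀` and at `w`, beyond `c`.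
  obtain ⟨ε, hε0, hε⟩ := exists_le_delay_of_Icc h3 (ℓ := s₀.1.loc) (t₀ := s₀.1.val default)
    hcw hb (fun t _ τ h1 h2 => ⟨e, 𝒜.enabled_of_thresholdEquiv (s := s₁.1.shift τ₁)
      (s' := ⟨s₀.1.loc, fun _ => t + τ⟩) hK hl₁ (hsub (fun _ => t + τ) h1 h2) he⟩) (by
      intro t h1 h2
      have h5 := ((𝒜.enabled_iff _ _).mp he)
      have h6 : s₁.1.loc = e.1.source := h5.1
      have h4 := h5.2.1
      rw [← h6, hl₁] at h4
      refine s₀.2.of_le_of_le h4 (fun x => ?_) (fun x => ?_)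
      · rwa [Unique.eq_default x]
      · rw [Unique.eq_default x]; exact h2.trans hcw.le)
  refine ⟨ε, hε0, fun s hs hle => ?_⟩
  have hval : s.1.val = fun _ => s.1.val default := eq_const_of_unique s.1.val
  have hs' : s.1 = ⟨s₀.1.loc, fun _ => s.1.val default⟩ :=
    Config.ext (regionOf_eq_iff.mp hs).1 hval
  have hinv : (𝒜.inv s₀.1.loc).Sat fun _ => s.1.val default := by
    have := s.2
    rw [hs'] at this
    exact this
  have hs'' : s = ⟨⟨s₀.1.loc, fun _ => s.1.val default⟩, hinv⟩ := Subtype.ext hs'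
  refine (hε _ ⟨hle default, (hlt s hs).le⟩ hinv).trans ?_
  rw [← hs'']
  refine measure_mono fun τ hτ hr => ?_
  have := ((hr c hc default).1.mp (hlt s hs)).trans hcw
  exact absurd this (not_lt.mpr hτ)

end StochasticTimedAutomaton
end TimedAut

namespace TimedAut

open TimedAutomaton Filter Topology

namespace StochasticTimedAutomaton

variable {L X : Type*} {𝒜 : StochasticTimedAutomaton L X} {K : Finset ℕ}

/-! ### Fairness -/

theorem moveKernel_regionMoves_ne_zero [Unique X] (hK : ∀ c, 𝒜.IsConstant c → c ∈ K)
    {f : 𝒜.RegionEdge} (hf : f ∈ 𝒜.regionEdges (thresholdEquiv K))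
    (ht : ¬ 𝒜.Thin (thresholdEquiv K) f) {s : 𝒜.State}
    (hs : regionOf (thresholdEquiv K) s.1 = f.source) :
    𝒜.moveKernel s (𝒜.regionMoves K f) ≠ 0 := by
  have h := 𝒜.le_moveKernel (ordConnected_shift_region (K := K) s.1.val f.through).measurableSet
    (measurableSet_regionMoves hf)
    (fun τ hτ => (𝒜.mem_delaysOf_iff s τ _).mpr (enabled_of_mem_regionEdges hK hf hs hτ))
    (fun τ hτ => ⟨hs, hτ, rfl⟩)
  refine (lt_of_lt_of_le (pos_iff_ne_zero.mpr (mul_ne_zero ?_ ?_)) h).ne'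
  · exact_mod_cast 𝒜.edgeBound_pos.ne'
  · exact delay_regionDelaysOf_ne_zero hK hf ht hs

/-- Delays along `f` have positive mass and almost all delays stay in the region, so `f` passes
through the source region itself. Its delays then have probability `1`, and only the choice of the
edge costs anything. -/
theorem edgeBound_le_moveKernel_regionMoves [Unique X] (hK : ∀ c, 𝒜.IsConstant c → c ∈ K)
    {f : 𝒜.RegionEdge} (hf : f ∈ 𝒜.regionEdges (thresholdEquiv K))
    (ht : ¬ 𝒜.Thin (thresholdEquiv K) f) {s : 𝒜.State}
    (hs : regionOf (thresholdEquiv K) s.1 = f.source)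
    (h0 : 𝒜.delay s {τ | ¬ thresholdEquiv K s.1.val (s.1.val.shift τ)} = 0) :
    (𝒜.edgeBound : ℝ≥0∞) ≤ 𝒜.moveKernel s (𝒜.regionMoves K f) := by
  have hT := (ordConnected_shift_region (K := K) s.1.val f.through).measurableSet
  have h := 𝒜.le_moveKernel hT (measurableSet_regionMoves hf)
    (fun τ hτ => (𝒜.mem_delaysOf_iff s τ _).mpr (enabled_of_mem_regionEdges hK hf hs hτ))
    (fun τ hτ => ⟨hs, hτ, rfl⟩)
  obtain ⟨τ, hτ, hτ'⟩ : ∃ τ, region (thresholdEquiv K) (s.1.val.shift τ) = f.through ∧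
      thresholdEquiv K s.1.val (s.1.val.shift τ) := by
    by_contra hcon
    push Not at hcon
    exact delay_regionDelaysOf_ne_zero hK hf ht hs (measure_mono_null hcon h0)
  have h1 : 𝒜.delay s {τ | region (thresholdEquiv K) (s.1.val.shift τ) = f.through} = 1 := by
    refine (prob_compl_eq_zero_iff hT).mp (measure_mono_null ?_ h0)
    intro τ' h1 h2
    refine h1 ?_
    exact (region_eq_iff.mpr (h2.symm.trans hτ')).trans hτ
  rwa [h1, mul_one] at h

/-- The moves whose delay leaves the region. -/
def leaveMoves (𝒜 : StochasticTimedAutomaton L X) (K : Finset ℕ) : Set 𝒜.Move :=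
  {m | ¬ thresholdEquiv K m.1.1.val (m.1.1.val.shift m.2.1)}

theorem measurableSet_leaveMoves [Countable X] : MeasurableSet (𝒜.leaveMoves K) := by
  have h1 : Measurable fun m : 𝒜.Move => m.1.1 := measurable_subtype_coe.comp measurable_fst
  exact (measurableSet_thresholdEquiv K (measurable_val.comp h1)
    (measurable_val.comp (measurable_shift.comp (h1.prodMk measurable_snd.fst)))).compl

theorem ae_frequently_regionMoves [Finite L] [Unique X] (h3 : 𝒜.ContinuousDelays)
    (hK : ∀ c, 𝒜.IsConstant c → c ∈ K) {f : 𝒜.RegionEdge}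
    (hf : f ∈ 𝒜.regionEdges (thresholdEquiv K)) (ht : ¬ 𝒜.Thin (thresholdEquiv K) f)
    (s : 𝒜.State) : ∀ᵐ ρ ∂𝒜.law s,
      (∃ᶠ n in atTop, regionOf (thresholdEquiv K) (ρ n).1.1 = f.source) →
        ∃ᶠ n in atTop, ρ n ∈ 𝒜.regionMoves K f := by
  have hD := measurableSet_regionMoves hf
  filter_upwards [𝒜.ae_law_runs s, 𝒜.ae_frequently_or_eventually hD s,
    𝒜.ae_frequently_mem hD s, 𝒜.ae_frequently_mem (measurableSet_leaveMoves (K := K)) s]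
    with ρ hρ hrec hBD hBL hq
  by_contra hnD
  have hstate : ∀ z, ¬ ∃ᶠ n in atTop, (ρ n).1 = z := by
    intro z hz
    rcases hrec z hz with h | h
    · exact hnD h
    · obtain ⟨n, h1, h2⟩ := (hq.and_eventually h).exists
      exact moveKernel_regionMoves_ne_zero hK hf ht h1 h2
  -- There is one configuration of clock value `0` per location; if the value `0` recurred, one of
  -- these finitely many would recur.
  have hzero : ∀ᶠ n in atTop, (ρ n).1.1.val default ≠ 0 := by
    have : ∀ᶠ n in atTop, ∀ ℓ : L, ¬ ((ρ n).1.1.loc = ℓ ∧ (ρ n).1.1.val default = 0) := by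
      rw [eventually_all]
      intro ℓ
      by_contra h
      have h' : ∃ᶠ n in atTop, (ρ n).1.1.loc = ℓ ∧ (ρ n).1.1.val default = 0 := h
      obtain ⟨m, hm⟩ := h'.exists
      refine hstate (ρ m).1 (h'.mono fun n hn => Subtype.ext (Config.ext ?_ ?_))
      · rw [hn.1, hm.1]
      · ext x
        rw [Unique.eq_default x, hn.2, hm.2]
    filter_upwards [this] with n hn h
    exact hn _ ⟨rfl, h⟩
  obtain ⟨n₀, hn₀⟩ := eventually_atTop.mp hzero
  have hshift : ∀ n ≥ n₀, (ρ (n + 1)).1.1.val = (ρ n).1.1.val.shift (ρ n).2.1 := by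
    intro n hn
    have h1 := (hρ.2 n).2.2.2.2.1
    have h2 := hn₀ (n + 1) (by omega)
    by_cases hx : default ∈ (ρ n).2.2.1.resets
    · exact absurd (by rw [h1]; simp [Valuation.reset, hx]) h2
    · ext x
      rw [h1, Unique.eq_default x]
      simp [Valuation.reset, hx]
  have hmono : ∀ n ≥ n₀, ∀ m ≥ n, (ρ n).1.1.val ≤ (ρ m).1.1.val := by
    intro n hn m hm
    induction m, hm using Nat.le_induction with
    | base => exact le_rfl
    | succ m hm ih =>
      rw [hshift m (hn.trans hm)]
      exact ih.trans (Valuation.le_shift _ _)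
  obtain ⟨n₁, hn₁, hq₁⟩ := frequently_atTop.mp hq n₀
  -- The valuation at time `n` lies between two visits to `q`.
  have hR : ∀ n ≥ n₁, thresholdEquiv K (ρ n₁).1.1.val (ρ n).1.1.val := by
    intro n hn
    obtain ⟨m, hm, hqm⟩ := frequently_atTop.mp hq n
    have h1 := (regionOf_eq_iff.mp (hq₁.trans hqm.symm)).2
    exact h1.of_le_of_le (hmono n₁ hn₁ n hn) (hmono n (le_trans hn₁ hn) m hm)
  have hgap : ∀ c ∈ K, (ρ n₁).1.1.val default ≠ c := by
    intro c hc h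
    refine hstate (ρ n₁).1 (hq.mono fun n hn => Subtype.ext ?_)
    obtain ⟨h1, h2⟩ := regionOf_eq_iff.mp (hq₁.trans hn.symm)
    refine Config.ext h1.symm ?_
    ext x
    rw [Unique.eq_default x, h, (h2 c hc default).2.mp h]
  have hstay : ∃ τ e, 𝒜.Enabled ((ρ n₁).1.1.shift τ) e ∧
      thresholdEquiv K (ρ n₁).1.1.val ((ρ n₁).1.1.val.shift τ) := by
    refine ⟨_, _, ((𝒜.step_iff _ _ _ _).mp (hρ.2 n₁)).1, ?_⟩
    rw [← hshift n₁ hn₁]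
    exact hR _ (Nat.le_succ _)
  rcases leave_dichotomy h3 hK hgap hstay with h | ⟨ε, hε0, hε⟩
  · obtain ⟨j, hj⟩ := exists_inv_le (x := 𝒜.edgeBound) (by exact_mod_cast 𝒜.edgeBound_pos.ne')
    refine hnD (hBD j (hq.mono fun n hn => hj.trans ?_))
    exact edgeBound_le_moveKernel_regionMoves hK hf ht hn (h _ (hn.trans hq₁.symm))
  · obtain ⟨j, hj⟩ := exists_inv_le hε0
    have hL : ∃ᶠ n in atTop, ρ n ∈ 𝒜.leaveMoves K := by
      refine hBL j ((hq.and_eventually (eventually_ge_atTop n₁)).mono fun n hn => hj.trans ?_)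
      refine (hε _ (hn.1.trans hq₁.symm) (hmono n₁ hn₁ n hn.2)).trans ?_
      refine 𝒜.moveKernel_delay ?_ measurableSet_leaveMoves fun τ hτ e => hτ
      exact (measurableSet_thresholdEquiv K measurable_const
        (measurable_pi_lambda _ fun x => measurable_const.add measurable_id)).compl
    -- Without a reset, the valuation after the delay is that of the next state, which lies in the
    -- same region.
    obtain ⟨n, hn, hnL⟩ := frequently_atTop.mp hL n₁
    refine hnL ?_
    rw [← hshift n (le_trans hn₁ hn)]
    exact (hR n hn).symm.trans (hR (n + 1) (by omega))

/-! ### Measurability of fairness and passage to the space of runs -/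

instance (s : 𝒜.State) : IsProbabilityMeasure (𝒜.law s) := by
  have : IsProbabilityMeasure ((𝒜.moveKernel s).map fun m (_ : Finset.Iic 0) => m) :=
    Measure.isProbabilityMeasure_map (by fun_prop)
  unfold law
  infer_instance

theorem fair_iff {s : 𝒜.State} (ρ : 𝒜.Runs s) : 𝒜.Fair (thresholdEquiv K) ρ ↔
    ∀ f ∈ {f ∈ 𝒜.regionEdges (thresholdEquiv K) | ¬ 𝒜.Thin (thresholdEquiv K) f},
      (∃ᶠ n in atTop, regionOf (thresholdEquiv K) (ρ.1 n).1.1 = f.source) →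
        ∃ᶠ n in atTop, ρ.1 n ∈ 𝒜.regionMoves K f := by
  have h : ∀ f ∈ 𝒜.regionEdges (thresholdEquiv K), ∀ n, 𝒜.regionEdgeOf (thresholdEquiv K)
      (ρ.1 n).1.1 (ρ.1 n).2.1 (ρ.1 n).2.2 (ρ.1 (n + 1)).1.1 = f ↔
        ρ.1 n ∈ 𝒜.regionMoves K f := by
    intro f hf n
    rw [((𝒜.step_iff _ _ _ _).mp (ρ.2.2 n)).2, mem_regionMoves_iff hf]
  simp only [Fair, Nat.frequently_atTop_iff_infinite, Set.mem_ofPred_eq, and_imp]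
  refine forall₂_congr fun f hf => ?_
  simp only [h f hf]

theorem measurableSet_fair [Finite L] [Finite X] (s : 𝒜.State) :
    MeasurableSet {ρ : 𝒜.Runs s | 𝒜.Fair (thresholdEquiv K) ρ} := by
  simp only [fair_iff]
  rw [Set.ofPred_forall]
  simp only [Set.ofPred_forall]
  refine MeasurableSet.biInter ((𝒜.countable_regionEdges K).mono (Set.sep_subset _ _))
    fun f hf => ?_
  have hm : ∀ n, Measurable fun ρ : 𝒜.Runs s => ρ.1 n := fun n =>
    (measurable_pi_apply n).comp measurable_subtype_coe
  have h1 : ∀ n, MeasurableSet {ρ : 𝒜.Runs s |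
      regionOf (thresholdEquiv K) (ρ.1 n).1.1 = f.source} := by
    obtain ⟨⟨s₀, τ, e, s', -, rfl⟩, -⟩ := hf
    exact fun n => (measurable_fst.comp (hm n)) (measurableSet_regionOf s₀)
  have h2 : ∀ n, MeasurableSet {ρ : 𝒜.Runs s | ρ.1 n ∈ 𝒜.regionMoves K f} :=
    fun n => hm n (measurableSet_regionMoves hf.1)
  have := (measurableSet_frequently h1).compl.union (measurableSet_frequently h2)
  convert! this using 1
  ext ρ
  exact imp_iff_not_or

theorem prob_fair [Finite L] [Unique X] (h3 : 𝒜.ContinuousDelays)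
    (hK : ∀ c, 𝒜.IsConstant c → c ∈ K) (s : 𝒜.State) :
    𝒜.prob s {ρ | 𝒜.Fair (thresholdEquiv K) ρ} = 1 := by
  have hemb : MeasurableEmbedding (Subtype.val : 𝒜.Runs s → ℕ → 𝒜.Move) :=
    MeasurableEmbedding.subtype_coe (𝒜.measurableSet_runs s)
  rw [prob, hemb.comap_apply, ← mem_ae_iff_prob_eq_one
    (hemb.measurableSet_image.mpr (measurableSet_fair s))]
  have h := (ae_ball_iff ((𝒜.countable_regionEdges K).mono (Set.sep_subset _ fun f =>
    ¬ 𝒜.Thin (thresholdEquiv K) f))).mpr fun f hf => ae_frequently_regionMoves h3 hK hf.1 hf.2 s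
  filter_upwards [𝒜.ae_law_runs s, h] with ρ h1 h2
  exact ⟨⟨ρ, h1⟩, (fair_iff _).mpr h2, rfl⟩

end StochasticTimedAutomaton

/-! ### The standard regions and the coarse regions of a single clock -/

namespace TimedAutomaton

variable {L X : Type*} (A : TimedAutomaton L X)

theorem coarseEquiv_eq [Finite L] :
    A.CoarseEquiv = thresholdEquiv (insert 0 A.finite_isConstant.toFinset) := by
  funext v v'
  simp [CoarseEquiv, thresholdEquiv]

theorem le_maxConstant [Finite L] {c : ℕ} (hc : A.IsConstant c) : c ≤ A.maxConstant :=
  le_csSup A.finite_isConstant.bddAbove hc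

/-- For values at most `M`, comparisons with `0, …, M` reveal the integer part and whether the value
is an integer; beyond `M` they reveal nothing more. -/
theorem floor_fract_iff {M : ℕ} {a b : ℝ≥0} :
    (((M : ℝ≥0) < a ∧ (M : ℝ≥0) < b) ∨ (⌊(a : ℝ)⌋ = ⌊(b : ℝ)⌋ ∧
      (Int.fract (a : ℝ) = 0 ↔ Int.fract (b : ℝ) = 0))) ↔
    ∀ c ∈ Finset.Iic M, (a < c ↔ b < c) ∧ (a = c ↔ b = c) := by
  have hlt : ∀ (u : ℝ≥0) (c : ℕ), u < c ↔ ⌊(u : ℝ)⌋ < (c : ℤ) := by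
    intro u c
    rw [Int.floor_lt, ← NNReal.coe_lt_coe]
    simp
  have heq : ∀ (u : ℝ≥0) (c : ℕ), u = c ↔ ⌊(u : ℝ)⌋ = (c : ℤ) ∧ Int.fract (u : ℝ) = 0 := by
    intro u c
    have h := Int.floor_add_fract (u : ℝ)
    rw [← NNReal.coe_inj, NNReal.coe_natCast]
    constructor
    · intro h'
      rw [h']
      simp
    · rintro ⟨h1, h2⟩
      rw [h1, h2] at h
      simpa using h.symm
  constructor
  · rintro (⟨h1, h2⟩ | ⟨h1, h2⟩) c hc
    · have hcM : (c : ℝ≥0) ≤ M := by exact_mod_cast Finset.mem_Iic.mp hc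
      exact ⟨iff_of_false (hcM.trans h1.le).not_gt (hcM.trans h2.le).not_gt,
        iff_of_false (hcM.trans_lt h1).ne' (hcM.trans_lt h2).ne'⟩
    · rw [hlt, hlt, heq, heq, h1, h2]
      exact ⟨Iff.rfl, Iff.rfl⟩
  · intro h
    by_cases ha : (M : ℝ≥0) < a
    · have hM := h M (by simp)
      refine Or.inl ⟨ha, lt_of_le_of_ne (not_lt.mp fun h' => ?_) fun h' => ?_⟩
      · exact absurd (hM.1.mpr h') ha.not_gt
      · exact ha.ne' (hM.2.mpr h'.symm)
    · right
      rw [not_lt] at ha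
      obtain ⟨n, hn⟩ := Int.eq_ofNat_of_zero_le (Int.floor_nonneg.mpr a.2)
      change ⌊(a : ℝ)⌋ = (n : ℤ) at hn
      have hna : (n : ℝ≥0) ≤ a := by
        rw [← not_lt, hlt, hn]
        exact lt_irrefl _
      have hnM : n ≤ M := by exact_mod_cast hna.trans ha
      have h1 := h n (Finset.mem_Iic.mpr hnM)
      by_cases hna' : a = n
      · rw [hna', h1.2.mp hna']
        simp
      -- As `a ≤ M` is not an integer, `n + 1` is also an available threshold, and `n`, `n + 1`
      -- enclose `b`.
      · have hnM' : n + 1 ≤ M := by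
          have : (n : ℝ≥0) < M := (lt_of_le_of_ne hna (Ne.symm hna')).trans_le ha
          exact_mod_cast this
        have h2 := (h (n + 1) (Finset.mem_Iic.mpr hnM')).1
        rw [hlt, hlt, hn] at h2
        have h3 := h1.1
        rw [hlt, hlt, hn] at h3
        have hb : ⌊(b : ℝ)⌋ = (n : ℤ) := by
          have h4 := h2.mp (by push_cast; omega)
          have h5 : ¬ ⌊(b : ℝ)⌋ < (n : ℤ) := fun h' => lt_irrefl _ (h3.mpr h')
          push_cast at h4
          omega
        refine ⟨hn.trans hb.symm, iff_of_false (fun h' => hna' ?_) fun h' => hna' ?_⟩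
        · exact (heq a n).mpr ⟨hn, h'⟩
        · exact h1.2.mpr ((heq b n).mpr ⟨hb, h'⟩)

/-- With one clock, the comparison of fractional parts is between a value and itself. -/
theorem standardEquiv_eq [Subsingleton X] :
    A.StandardEquiv = thresholdEquiv (Finset.Iic A.maxConstant) := by
  funext v v'
  refine propext ⟨fun h c hc x => floor_fract_iff.mp (h.1 x) c hc, fun h => ⟨fun x =>
    floor_fract_iff.mpr fun c hc => h c hc x, fun x y _ _ => ?_⟩⟩
  rw [Subsingleton.elim x y]
  simp

end TimedAutomaton
end TimedAut

theorem mainTheorem6 {L X : Type*} [Finite L] [Finite X] (hX : Nat.card X = 1)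
    (𝒜 : TimedAut.StochasticTimedAutomaton L X)
    (h3 : 𝒜.ContinuousDelays) (h4 : 𝒜.MonotoneDelays) (h5 : 𝒜.BoundedRates) (s : 𝒜.State) :
    (MeasurableSet {ρ : 𝒜.Runs s | 𝒜.Fair 𝒜.StandardEquiv ρ} ∧
      𝒜.prob s {ρ | 𝒜.Fair 𝒜.StandardEquiv ρ} = 1) ∧
    (MeasurableSet {ρ : 𝒜.Runs s | 𝒜.Fair 𝒜.CoarseEquiv ρ} ∧
      𝒜.prob s {ρ | 𝒜.Fair 𝒜.CoarseEquiv ρ} = 1) := by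
  obtain ⟨hs, hne⟩ := Nat.card_eq_one_iff_unique.mp hX
  have : Unique X := ⟨⟨hne.some⟩, fun _ => Subsingleton.elim _ _⟩
  rw [𝒜.standardEquiv_eq, 𝒜.coarseEquiv_eq]
  refine ⟨⟨TimedAut.StochasticTimedAutomaton.measurableSet_fair s,
    TimedAut.StochasticTimedAutomaton.prob_fair h3 (fun c hc => ?_) s⟩,
    ⟨TimedAut.StochasticTimedAutomaton.measurableSet_fair s,
      TimedAut.StochasticTimedAutomaton.prob_fair h3 (fun c hc => ?_) s⟩⟩
  · exact Finset.mem_Iic.mpr (𝒜.le_maxConstant hc)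
  · exact Finset.mem_insert_of_mem (𝒜.finite_isConstant.mem_toFinset.mpr hc)
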